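/- \textbf{Conventions.} Let $\mathfrak{vir}$ be the complex Virasoro Lie algebra with basis $L_n$ ($n\in\mathbb{Z}$) and $C$, with brackets $[L_m,L_n]=(m-n)L_{m+n}+\delta_{m+n,0}\,\frac{m^3-m}{12}\,C$ and $[L_m,C]=0$. A \emph{highest weight module} of highest weight $h$ and central charge $c$ is a $\mathfrak{vir}$-module generated by a vector $x\neq 0$ with $L_0x=hx$, $Cx=cx$ and $L_nx=0$ for all $n>0$. The \emph{Verma module} $\mathcal{V}_{h,c}$ is the quotient of the universal enveloping algebra of $\mathfrak{vir}$ by the left ideal generated by $L_0-h$, $C-c$ and the $L_n$ with $n>0$. Given highest weight modules $\mathcal{H}^{L}$ (the left module) and $\mathcal{H}^{R}$ (the right module), a \emph{staggered module} with these left and right modules is an indecomposable $\mathfrak{vir}$-module $\mathcal{S}$, on which $C$ acts diagonalisably, together with a short exact sequence of $\mathfrak{vir}$-modules $$0\longrightarrow \mathcal{H}^{L}\overset{\iota}{\longrightarrow}\mathcal{S}\overset{\pi}{\longrightarrow}\mathcal{H}^{R}\longrightarrow 0,$$ such that $L_0$ is not diagonalisable on $\mathcal{S}$, but has Jordan cells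 of rank at most $2$ (that is, $\mathcal{S}$ is spanned by vectors annihilated by some $(L_0-\mu)^2$, $\mu\in\mathbb{C}$). \textbf{Theorem.} Let $c,h^{L},h^{R}\in\mathbb{R}$ with $h^{L}=h^{R}$. Let $\mathcal{H}^{L}$ be any highest weight module of highest weight $h^{L}$ and central charge $c$, and let $\mathcal{H}^{R}$ be isomorphic to the Verma module $\mathcal{V}_{h^{R},c}$. Then there exists a staggered module with left module $\mathcal{H}^{L}$ and right module $\mathcal{H}^{R}$, and it is unique up to isomorphism: for any two such staggered modules $(\mathcal{S},\iota,\pi)$ and $(\mathcal{S}',\iota',\pi')$ there is an isomorphism of $\mathfrak{vir}$-modules $\psi\colon\mathcal{S}'\to\mathcal{S}$ with $\psi\circ\iota'=\iota$. -/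

import Mathlib

universe u v w

/-- The underlying complex vector space of the Virasoro algebra: the direct sum of the space
with basis `L n` (`n : ℤ`) and the line spanned by the central element `C`. -/
def Virasoro : Type := (ℤ →₀ ℂ) × ℂ

namespace Virasoro

noncomputable instance : AddCommGroup Virasoro := inferInstanceAs (AddCommGroup ((ℤ →₀ ℂ) × ℂ))

noncomputable instance : Module ℂ Virasoro := inferInstanceAs (Module ℂ ((ℤ →₀ ℂ) × ℂ))

/-- The mode `L n`. -/
noncomputable def L (n : ℤ) : Virasoro := (Finsupp.single n 1, 0)

/-- The central element `C`. -/
def C : Virasoro := (0, 1)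

/-- Projection of the Virasoro algebra onto the span of the modes `L n`, along `C`. -/
noncomputable def modes : Virasoro →ₗ[ℂ] (ℤ →₀ ℂ) := LinearMap.fst ℂ (ℤ →₀ ℂ) ℂ

/-- The bracket of two modes,
`[L m, L n] = (m - n) L (m + n) + δ_{m + n, 0} (m ^ 3 - m) / 12 C`. -/
noncomputable def modeBracket (m n : ℤ) : Virasoro :=
  ((m : ℂ) - n) • L (m + n) + (if m + n = 0 then ((m : ℂ) ^ 3 - m) / 12 else 0) • C

/-- The Virasoro bracket as a bilinear map: the bilinear extension of `modeBracket`, with `C`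
central. -/
noncomputable def bracketMap : Virasoro →ₗ[ℂ] Virasoro →ₗ[ℂ] Virasoro :=
  (Finsupp.linearCombination ℂ fun m : ℤ =>
    (Finsupp.linearCombination ℂ (modeBracket m)).comp modes).comp modes

theorem modes_L (n : ℤ) : modes (L n) = Finsupp.single n 1 := rfl

theorem modes_C : modes C = 0 := rfl

theorem bracketMap_L_L (m n : ℤ) : bracketMap (L m) (L n) = modeBracket m n := by
  simp [bracketMap, modes_L]

theorem bracketMap_C_left (x : Virasoro) : bracketMap C x = 0 := by
  simp [bracketMap, modes_C]

theorem bracketMap_C_right (x : Virasoro) : bracketMap x C = 0 := by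
  suffices h : bracketMap.flip C = 0 from LinearMap.congr_fun h x
  refine LinearMap.ext fun y => ?_
  simp [bracketMap, Finsupp.linearCombination_apply, modes_C, Finsupp.sum]

/-- Linear maps out of the Virasoro algebra are determined by their values on `L n` and `C`. -/
theorem hom_ext {M : Type*} [AddCommGroup M] [Module ℂ M] {f g : Virasoro →ₗ[ℂ] M}
    (hL : ∀ n, f (L n) = g (L n)) (hC : f C = g C) : f = g := by
  refine LinearMap.prod_ext (R := ℂ) (M := ℤ →₀ ℂ) (M₂ := ℂ) ?_ ?_
  · exact Finsupp.lhom_ext' fun n => LinearMap.ext_ring (hL n)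
  · exact LinearMap.ext_ring hC

theorem bracketMap_skew (x y : Virasoro) : bracketMap x y = -bracketMap y x := by
  suffices h : bracketMap = -bracketMap.flip from LinearMap.congr_fun₂ h x y
  refine hom_ext (fun m => hom_ext (fun n => ?_) ?_) (hom_ext (fun n => ?_) ?_)
  · simp only [LinearMap.neg_apply, LinearMap.flip_apply, bracketMap_L_L, modeBracket,
      add_comm n m]
    by_cases h : m + n = 0
    · obtain rfl : n = -m := by omega
      simp only [add_neg_cancel, if_true]
      push_cast
      module
    · simp only [h, if_false]
      module
  all_goals simp [bracketMap_C_left, bracketMap_C_right]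

theorem bracketMap_jacobi (x y z : Virasoro) :
    bracketMap x (bracketMap y z) =
      bracketMap (bracketMap x y) z + bracketMap y (bracketMap x z) := by
  suffices h : ∀ x y, bracketMap x ∘ₗ bracketMap y =
      bracketMap (bracketMap x y) + bracketMap y ∘ₗ bracketMap x from
    LinearMap.congr_fun (h x y) z
  clear x y z
  intro x y
  suffices h : (LinearMap.llcomp ℂ Virasoro Virasoro Virasoro).compl₁₂ bracketMap bracketMap =
      bracketMap.compr₂ bracketMap +
        ((LinearMap.llcomp ℂ Virasoro Virasoro Virasoro).compl₁₂ bracketMap bracketMap).flip from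
    LinearMap.congr_fun₂ h x y
  refine hom_ext (fun m => hom_ext (fun n => hom_ext (fun p => ?_) ?_) ?_)
    (hom_ext (fun n => hom_ext (fun p => ?_) ?_) ?_)
  · simp only [LinearMap.compl₁₂_apply, LinearMap.llcomp_apply', LinearMap.comp_apply,
      LinearMap.add_apply, LinearMap.compr₂_apply, LinearMap.flip_apply, bracketMap_L_L]
    simp only [modeBracket, map_add, map_smul, LinearMap.add_apply, LinearMap.smul_apply,
      bracketMap_C_left, bracketMap_C_right, bracketMap_L_L, smul_zero, add_zero]
    rw [show m + (n + p) = m + n + p by ring, show n + (m + p) = m + n + p by ring]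
    by_cases h : m + n + p = 0
    · obtain rfl : p = -m - n := by omega
      simp only [h, if_true]
      push_cast
      module
    · simp only [h, if_false]
      push_cast
      module
  all_goals
    try refine LinearMap.ext fun z => ?_
    simp [LinearMap.compl₁₂_apply, LinearMap.llcomp_apply', bracketMap_C_left,
      bracketMap_C_right]

noncomputable instance : LieRing Virasoro where
  bracket x y := bracketMap x y
  add_lie x y z := by simp
  lie_add x y z := by simp
  lie_self x := by
    have : IsAddTorsionFree Virasoro := .of_isTorsionFree ℂ Virasoro
    exact self_eq_neg.mp (bracketMap_skew x x)
  leibniz_lie x y z := bracketMap_jacobi x y z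

noncomputable instance : LieAlgebra ℂ Virasoro where
  lie_smul t x y := map_smul (bracketMap x) t y

theorem lie_L_L (m n : ℤ) :
    ⁅L m, L n⁆ =
      ((m : ℂ) - n) • L (m + n) + (if m + n = 0 then ((m : ℂ) ^ 3 - m) / 12 else 0) • C :=
  bracketMap_L_L m n

theorem lie_C_right (x : Virasoro) : ⁅x, C⁆ = 0 := bracketMap_C_right x

/-! ### Highest weight modules and Verma modules -/

/-- `x` is a highest weight vector of conformal dimension `h` and central charge `c`. -/
structure IsHighestWeightVector {M : Type*} [AddCommGroup M] [Module ℂ M]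
    [LieRingModule Virasoro M] (c h : ℂ) (x : M) : Prop where
  ne_zero : x ≠ 0
  L_zero : ⁅L 0, x⁆ = h • x
  C_apply : ⁅C, x⁆ = c • x
  L_pos : ∀ n : ℤ, 0 < n → ⁅L n, x⁆ = 0

/-- `M` is a highest weight module of highest weight `h` and central charge `c`: it is generated
by a single highest weight vector. -/
def IsHighestWeightModule (c h : ℂ) (M : Type*) [AddCommGroup M] [Module ℂ M]
    [LieRingModule Virasoro M] : Prop :=
  ∃ x : M, IsHighestWeightVector c h x ∧ LieSubmodule.lieSpan ℂ Virasoro {x} = ⊤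

/-- The universal enveloping algebra of the Virasoro algebra. -/
abbrev UEA : Type := UniversalEnvelopingAlgebra ℂ Virasoro

/-- The left ideal of the universal enveloping algebra generated by `C - c`, `L 0 - h` and the
`L n` with `n > 0`. -/
noncomputable def vermaIdeal (c h : ℂ) : Submodule UEA UEA :=
  Submodule.span UEA
    ({UniversalEnvelopingAlgebra.ι ℂ C - algebraMap ℂ UEA c,
      UniversalEnvelopingAlgebra.ι ℂ (L 0) - algebraMap ℂ UEA h} ∪
      {a | ∃ n : ℤ, 0 < n ∧ a = UniversalEnvelopingAlgebra.ι ℂ (L n)})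

/-- The Verma module of highest weight `h` and central charge `c`. -/
def Verma (c h : ℂ) : Type := UEA ⧸ vermaIdeal c h

noncomputable instance (c h : ℂ) : AddCommGroup (Verma c h) :=
  inferInstanceAs (AddCommGroup (UEA ⧸ vermaIdeal c h))

noncomputable instance (c h : ℂ) : Module UEA (Verma c h) :=
  inferInstanceAs (Module UEA (UEA ⧸ vermaIdeal c h))

noncomputable instance (c h : ℂ) : Module ℂ (Verma c h) :=
  inferInstanceAs (Module ℂ (UEA ⧸ vermaIdeal c h))

instance (c h : ℂ) : IsScalarTower ℂ UEA (Verma c h) :=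
  inferInstanceAs (IsScalarTower ℂ UEA (UEA ⧸ vermaIdeal c h))

/-- The Virasoro algebra acts on a Verma module by left multiplication. -/
noncomputable instance (c h : ℂ) : LieRingModule Virasoro (Verma c h) where
  bracket x m := UniversalEnvelopingAlgebra.ι ℂ x • m
  add_lie x y m := by simp [add_smul]
  lie_add x m n := smul_add _ m n
  leibniz_lie x y m := by
    simp only [LieHom.map_lie, LieRing.of_associative_ring_bracket, sub_smul, mul_smul]
    abel

instance (c h : ℂ) : LieModule ℂ Virasoro (Verma c h) where
  smul_lie t x m := by
    change UniversalEnvelopingAlgebra.ι ℂ (t • x) • m = t • UniversalEnvelopingAlgebra.ι ℂ x • m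
    rw [map_smul, smul_assoc]
  lie_smul t x m := by
    change UniversalEnvelopingAlgebra.ι ℂ x • t • m = t • UniversalEnvelopingAlgebra.ι ℂ x • m
    rw [← algebraMap_smul UEA t m, ← algebraMap_smul UEA t (UniversalEnvelopingAlgebra.ι ℂ x • m),
      ← mul_smul, ← mul_smul, Algebra.commutes]

/-! ### Staggered modules -/

/-- A Virasoro module is indecomposable if it is non-zero and is not the direct sum of two
non-zero submodules. -/
def IsIndecomposable (M : Type*) [AddCommGroup M] [Module ℂ M] [LieRingModule Virasoro M] :
    Prop :=
  Nontrivial M ∧ ∀ N₁ N₂ : LieSubmodule ℂ Virasoro M, IsCompl N₁ N₂ → N₁ = ⊥ ∨ N₂ = ⊥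

/-- An endomorphism of a complex vector space is diagonalisable if the space is spanned by its
eigenvectors. -/
def IsDiagonalisable {M : Type*} [AddCommGroup M] [Module ℂ M] (f : Module.End ℂ M) : Prop :=
  ⨆ μ : ℂ, f.eigenspace μ = ⊤

/-- An endomorphism of a complex vector space has a Jordan decomposition with cells of rank at
most two: the space is spanned by vectors killed by some `(f - μ) ^ 2`. -/
def HasJordanCellsOfRankLETwo {M : Type*} [AddCommGroup M] [Module ℂ M]
    (f : Module.End ℂ M) : Prop :=
  ⨆ μ : ℂ, f.genEigenspace μ 2 = ⊤

/-- Staggered modules with left module `HL` and right module `HR`: indecomposable Virasoro modules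
`S` with diagonalisable `C`, in a short exact sequence `0 → HL → S → HR → 0` with `HL` and `HR`
highest weight modules, such that `L 0` is not diagonalisable on `S` but has Jordan cells of rank
at most two. -/
structure StaggeredModule (HL : Type u) [AddCommGroup HL] [Module ℂ HL]
    [LieRingModule Virasoro HL] [LieModule ℂ Virasoro HL]
    (HR : Type v) [AddCommGroup HR] [Module ℂ HR]
    [LieRingModule Virasoro HR] [LieModule ℂ Virasoro HR] where
  /-- The underlying type of the module `S`. -/
  carrier : Type w
  [instAddCommGroup : AddCommGroup carrier]
  [instModule : Module ℂ carrier]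
  [instLieRingModule : LieRingModule Virasoro carrier]
  [instLieModule : LieModule ℂ Virasoro carrier]
  /-- The inclusion of the left module. -/
  ι : HL →ₗ⁅ℂ, Virasoro⁆ carrier
  /-- The projection onto the right module. -/
  π : carrier →ₗ⁅ℂ, Virasoro⁆ HR
  left_isHighestWeight : ∃ c h : ℂ, IsHighestWeightModule c h HL
  right_isHighestWeight : ∃ c h : ℂ, IsHighestWeightModule c h HR
  ι_injective : Function.Injective ι
  exact : Function.Exact ι π
  π_surjective : Function.Surjective π
  indecomposable : IsIndecomposable carrier
  C_diagonalisable : IsDiagonalisable (LieModule.toEnd ℂ Virasoro carrier C)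
  L_zero_not_diagonalisable : ¬ IsDiagonalisable (LieModule.toEnd ℂ Virasoro carrier (L 0))
  L_zero_jordan : HasJordanCellsOfRankLETwo (LieModule.toEnd ℂ Virasoro carrier (L 0))

attribute [instance] StaggeredModule.instAddCommGroup StaggeredModule.instModule
  StaggeredModule.instLieRingModule StaggeredModule.instLieModule

end Virasoro

/-!
Let `x` and `v` be the highest weight vectors that generate `HL` and the Verma module, and let `n`
be the Lie algebra spanned by the negative modes.

*Existence.* A staggered module has to contain a logarithmic partner `y` of `x`: a vector with
`L 0 y = h y + x`, `C y = c y` and `L n y = 0` for `n > 0`, which lifts a multiple of `v`. Such a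
module is built on `HL × U(n)` with `y = (0, 1)` and `n` acting by multiplication on `U(n)`. The action of `z` on `(0, a)`, for all `z` at once, is a linear map from the Virasoro
algebra to `HL × U(n)`; the relation `z (s a) = s (z a) + [z, s] a` for `s ∈ n` says that this
linear map depends `n`-equivariantly on `a`. It is therefore determined by its value at `a = 1`,
and exists because `U(n)` is the free `n`-module on one generator (`orbitMap`, `extAction`). By
induction on `a`, the result is a module as soon as the bracket relations hold on `y`
(`extAction_lie`), which is a computation with the non-negative modes (`extGen_lie`).

The quotient by `HL` is the Verma module: the map `a ↦ a v` from `U(n)` to the Verma module is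
surjective (`extLift_surjective`), and it is injective because the ideal that defines the Verma
module sends `y` into `HL`, so that `a` can be recovered from `a v` by acting on `y`
(`Verma.extLift_vac_injective`). The extension is indecomposable since every vector in the
generalised `h`-weight space outside `HL` generates it (`isIndecomposable_of_partner`).

*Uniqueness.* Any staggered module contains a logarithmic partner of `x` (`exists_partner`): a
generalised `L 0`-eigenvector that lifts `v`, rescaled. Weight considerations in `HL` show that the
positive modes annihilate it, and non-diagonalisability of `L 0` that the rescaling is possible.
The partner defines a homomorphism from the module constructed above, which is bijective by the
five lemma (`LogModule.lift_bijective`).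
-/

namespace Virasoro

attribute [local instance] LieRing.ofAssociativeRing

/-! ### Extending an action from a subalgebra to the whole Lie algebra -/

section Induction

variable {R : Type*} [CommRing R] {g : Type*} [LieRing g] [LieAlgebra R g] {n : LieSubalgebra R g}

/-- A submodule of a universal enveloping algebra that contains `1` and is stable under left
multiplication by the Lie algebra is the whole algebra. -/
theorem uea_induction {𝔤 : Type*} [LieRing 𝔤] [LieAlgebra R 𝔤]
    {p : UniversalEnvelopingAlgebra R 𝔤 → Prop}
    (one : p 1)
    (add : ∀ a b, p a → p b → p (a + b)) (smul : ∀ (r : R) a, p a → p (r • a))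
    (mul : ∀ (x : 𝔤) a, p a → p (UniversalEnvelopingAlgebra.ι R x * a))
    (a : UniversalEnvelopingAlgebra R 𝔤) : p a := by
  -- The elements whose left multiplication preserves `p` form a subalgebra containing `𝔤`.
  let P : Submodule R (UniversalEnvelopingAlgebra R 𝔤) :=
    { carrier := {a | p a}
      add_mem' := fun ha hb => add _ _ ha hb
      zero_mem' := by simpa using smul 0 1 one
      smul_mem' := fun r a ha => smul r a ha }
  let A : Subalgebra R (UniversalEnvelopingAlgebra R 𝔤) :=
    { carrier := {a | ∀ b ∈ P, a * b ∈ P}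
      mul_mem' := fun ha hb c hc => by rw [mul_assoc]; exact ha _ (hb _ hc)
      add_mem' := fun ha hb c hc => by rw [add_mul]; exact P.add_mem (ha _ hc) (hb _ hc)
      algebraMap_mem' := fun r c hc => by
        rw [← Algebra.smul_def]; exact P.smul_mem r hc }
  let F : UniversalEnvelopingAlgebra R 𝔤 →ₐ[R] A := UniversalEnvelopingAlgebra.lift R
    { toFun := fun x => ⟨UniversalEnvelopingAlgebra.ι R x, fun b hb => mul x b hb⟩
      map_add' := fun x y => Subtype.ext (by simp)
      map_smul' := fun r x => Subtype.ext (by simp)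
      map_lie' := fun {x y} => Subtype.ext (by
        simp [LieRing.of_associative_ring_bracket]) }
  have hF : A.val.comp F = AlgHom.id R _ := by
    ext x
    simp [F]
  have ha : a ∈ A := by
    have := (F a).2
    rwa [show ((F a : A) : UniversalEnvelopingAlgebra R 𝔤) = a from AlgHom.congr_fun hF a] at this
  have h1 := ha 1 one
  rwa [mul_one] at h1

variable {V : Type*} [AddCommGroup V] [Module R V]

/-- For a representation `ν` of a subalgebra `n` of `g` on `V`, the natural action of `n` on the
linear maps from `g` to `V`, where `n` acts on `g` by the adjoint action. -/
def homRep (ν : n →ₗ⁅R⁆ Module.End R V) : n →ₗ⁅R⁆ Module.End R (g →ₗ[R] V) where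
  toFun x :=
    { toFun := fun ψ => ν x ∘ₗ ψ - ψ ∘ₗ (LieAlgebra.ad R g (x : g) : g →ₗ[R] g)
      map_add' := fun ψ χ => by ext; simp; abel
      map_smul' := fun r ψ => by ext; simp [smul_sub] }
  map_add' x y := by ext; simp; abel
  map_smul' r x := by ext; simp [smul_sub]
  map_lie' {x y} := by
    ext ψ z
    simp [LieRing.of_associative_ring_bracket, map_sub]
    abel

theorem homRep_apply (ν : n →ₗ⁅R⁆ Module.End R V) (x : n) (ψ : g →ₗ[R] V) (z : g) :
    homRep ν x ψ z = ν x (ψ z) + ψ ⁅z, (x : g)⁆ := by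
  rw [← lie_skew]
  simp [homRep, sub_eq_add_neg, -lie_skew]

/-- The `n`-equivariant map from `U(n)` to the linear maps `g → V` that sends `1` to `φ`. -/
def orbitMap (ν : n →ₗ⁅R⁆ Module.End R V) (φ : g →ₗ[R] V) :
    UniversalEnvelopingAlgebra R n →ₗ[R] g →ₗ[R] V :=
  LinearMap.flip (UniversalEnvelopingAlgebra.lift R (homRep ν)).toLinearMap φ

theorem orbitMap_one (ν : n →ₗ⁅R⁆ Module.End R V) (φ : g →ₗ[R] V) : orbitMap ν φ 1 = φ := by
  simp [orbitMap]

theorem orbitMap_ι_mul (ν : n →ₗ⁅R⁆ Module.End R V) (φ : g →ₗ[R] V) (x : n)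
    (a : UniversalEnvelopingAlgebra R n) (z : g) :
    orbitMap ν φ (UniversalEnvelopingAlgebra.ι R x * a) z =
      ν x (orbitMap ν φ a z) + orbitMap ν φ a ⁅z, (x : g)⁆ := by
  rw [← homRep_apply]
  simp only [orbitMap, LinearMap.flip_apply, AlgHom.toLinearMap_apply, map_mul,
    UniversalEnvelopingAlgebra.lift_ι_apply, Module.End.mul_apply]

variable (n) (M : Type*) [AddCommGroup M] [Module R M] [LieRingModule g M] [LieModule R g M]

/-- The action of `n` on `M × U(n)`: the given one on `M`, left multiplication on `U(n)`. -/
noncomputable def prodRep : n →ₗ⁅R⁆ Module.End R (M × UniversalEnvelopingAlgebra R n) where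
  toFun x := (LieModule.toEnd R g M x).prodMap
    (LinearMap.mulLeft R (UniversalEnvelopingAlgebra.ι R x))
  map_add' x y := by ext <;> simp [-UniversalEnvelopingAlgebra.ι_apply, add_mul]
  map_smul' r x := by ext <;> simp
  map_lie' {x y} := by
    refine LinearMap.ext fun m => Prod.ext ?_ ?_
    · simp [LieRing.of_associative_ring_bracket]
    · simp [LieRing.of_associative_ring_bracket, sub_mul, mul_assoc]

variable {n M}

theorem prodRep_apply (x : n) (m : M) (a : UniversalEnvelopingAlgebra R n) :
    prodRep n M x (m, a) = (⁅(x : g), m⁆, UniversalEnvelopingAlgebra.ι R x * a) := rfl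

/-- The linear maps by which `g` acts on `M × U(n)`, when `z : g` sends `(0, 1)` to `φ z`. The
action of `z` on a product `x * a` with `x ∈ n` is forced by that on `a` through the commutator
`⁅z, x⁆`. -/
noncomputable def extAction (φ : g →ₗ[R] M × UniversalEnvelopingAlgebra R n) :
    g →ₗ[R] Module.End R (M × UniversalEnvelopingAlgebra R n) :=
  LinearMap.mk₂ R (fun z w => (⁅z, w.1⁆, 0) + orbitMap (prodRep n M) φ w.2 z)
    (fun z z' w => by ext <;> simp; abel) (fun r z w => by ext <;> simp)
    (fun z w w' => by ext <;> simp; abel) (fun r z w => by ext <;> simp)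

variable {φ : g →ₗ[R] M × UniversalEnvelopingAlgebra R n}

theorem extAction_apply (z : g) (m : M) (a : UniversalEnvelopingAlgebra R n) :
    extAction φ z (m, a) = (⁅z, m⁆, 0) + orbitMap (prodRep n M) φ a z := rfl

theorem extAction_inl (z : g) (m : M) : extAction φ z (m, 0) = (⁅z, m⁆, 0) := by
  simp [extAction_apply]

theorem extAction_one (z : g) : extAction φ z (0, 1) = φ z := by
  rw [extAction_apply, orbitMap_one]; simp

/-- The commutation relation between the actions of `n` and `g` on `M × U(n)`. -/
theorem extAction_prodRep (z : g) (x : n) (w : M × UniversalEnvelopingAlgebra R n) :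
    extAction φ z (prodRep n M x w) = prodRep n M x (extAction φ z w) +
      extAction φ ⁅z, (x : g)⁆ w := by
  obtain ⟨m, a⟩ := w
  have h : ((⁅z, ⁅(x : g), m⁆⁆, 0) : M × UniversalEnvelopingAlgebra R n) =
      prodRep n M x (⁅z, m⁆, 0) + (⁅⁅z, (x : g)⁆, m⁆, 0) := by
    rw [prodRep_apply, leibniz_lie]; simp [add_comm]
  rw [prodRep_apply]
  simp only [extAction_apply]
  rw [orbitMap_ι_mul, map_add, h]
  abel

theorem extAction_inr_ι_mul (z : g) (x : n) (a : UniversalEnvelopingAlgebra R n) :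
    extAction φ z (0, UniversalEnvelopingAlgebra.ι R x * a) =
      prodRep n M x (extAction φ z (0, a)) + extAction φ ⁅z, (x : g)⁆ (0, a) := by
  rw [← extAction_prodRep, prodRep_apply, lie_zero]

/-- On `n` the action is the evident one. -/
theorem extAction_coe (hφ : ∀ x : n, φ x = (0, UniversalEnvelopingAlgebra.ι R x)) (x : n) :
    extAction φ x = prodRep n M x := by
  suffices h : ∀ a (x : n), extAction φ (x : g) (0, a) = prodRep n M x (0, a) by
    refine LinearMap.ext fun w => ?_
    obtain ⟨m, a⟩ := w
    rw [show ((m, a) : M × UniversalEnvelopingAlgebra R n) = (m, 0) + (0, a) by simp, map_add,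
      map_add, h, extAction_inl, prodRep_apply x m, mul_zero]
  intro a
  induction a using uea_induction with
  | one => intro x; rw [extAction_one, hφ, prodRep_apply]; simp
  | add a b ha hb =>
    intro x
    rw [show ((0, a + b) : M × UniversalEnvelopingAlgebra R n) = (0, a) + (0, b) by simp, map_add,
      map_add, ha, hb]
  | smul r a ha =>
    intro x
    rw [show ((0, r • a) : M × UniversalEnvelopingAlgebra R n) = r • (0, a) by simp, map_smul,
      map_smul, ha]
  | mul y a ha =>
    intro x
    rw [extAction_inr_ι_mul, ha, ← LieSubalgebra.coe_bracket, ha, LieHom.map_lie,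
      LieRing.of_associative_ring_bracket, LinearMap.sub_apply, Module.End.mul_apply,
      Module.End.mul_apply, add_sub_cancel, prodRep_apply y, lie_zero]

/-- The action is one of Lie algebras as soon as the bracket relations hold on `(0, 1)`. -/
theorem extAction_lie
    (hφ' : ∀ x y, extAction φ x (φ y) - extAction φ y (φ x) = φ ⁅x, y⁆) (x y : g) :
    extAction φ ⁅x, y⁆ = ⁅extAction φ x, extAction φ y⁆ := by
  suffices h : ∀ a x y, extAction φ ⁅x, y⁆ (0, a) =
      extAction φ x (extAction φ y (0, a)) - extAction φ y (extAction φ x (0, a)) by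
    refine LinearMap.ext fun w => ?_
    obtain ⟨m, a⟩ := w
    rw [show ((m, a) : M × UniversalEnvelopingAlgebra R n) = (m, 0) + (0, a) by simp, map_add,
      map_add, h]
    simp only [LieRing.of_associative_ring_bracket, LinearMap.sub_apply, Module.End.mul_apply,
      extAction_inl, lie_lie, Prod.mk_sub_mk, sub_zero]
  clear x y
  intro a
  induction a using uea_induction with
  | one => intro x y; simp only [extAction_one, hφ']
  | add a b ha hb =>
    intro x y
    rw [show ((0, a + b) : M × UniversalEnvelopingAlgebra R n) = (0, a) + (0, b) by simp]
    simp only [map_add, ha, hb]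
    abel
  | smul r a ha =>
    intro x y
    rw [show ((0, r • a) : M × UniversalEnvelopingAlgebra R n) = r • (0, a) by simp]
    simp only [map_smul, ha, smul_sub]
  | mul t a ha =>
    intro x y
    simp only [extAction_inr_ι_mul, map_add, extAction_prodRep]
    rw [lie_lie x y (t : g)]
    rw [map_sub, LinearMap.sub_apply, ha x y, ha x ⁅y, (t : g)⁆, ha y ⁅x, (t : g)⁆, map_sub]
    abel

variable {T : Type*} [AddCommGroup T] [Module R T] [LieRingModule g T] [LieModule R g T]

variable {N : Type*} [AddCommGroup N] [Module R N]

/-- The linear map `N × U(n) → T` that is `j` on `N` and sends `a : U(n)` to `a • y`. -/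
noncomputable def extLift (n : LieSubalgebra R g) (j : N →ₗ[R] T) (y : T) :
    N × UniversalEnvelopingAlgebra R n →ₗ[R] T :=
  j.coprod (LinearMap.flip
    (UniversalEnvelopingAlgebra.lift R ((LieModule.toEnd R g T).comp n.incl)).toLinearMap y)

theorem extLift_inl (j : N →ₗ[R] T) (y : T) (m : N) : extLift n j y (m, 0) = j m := by
  simp [extLift]

theorem extLift_one (j : N →ₗ[R] T) (y : T) : extLift n j y (0, 1) = y := by
  simp [extLift]

theorem extLift_inr_ι_mul (j : N →ₗ[R] T) (y : T) (x : n) (a : UniversalEnvelopingAlgebra R n) :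
    extLift n j y (0, UniversalEnvelopingAlgebra.ι R x * a) = ⁅(x : g), extLift n j y (0, a)⁆ := by
  simp only [extLift, LinearMap.coprod_apply, map_zero, zero_add, LinearMap.flip_apply,
    AlgHom.toLinearMap_apply, map_mul, UniversalEnvelopingAlgebra.lift_ι_apply,
    Module.End.mul_apply]
  rfl

theorem extLift_prodRep (j : M →ₗ⁅R, g⁆ T) (y : T) (x : n)
    (w : M × UniversalEnvelopingAlgebra R n) :
    extLift n (j : M →ₗ[R] T) y (prodRep n M x w) = ⁅(x : g), extLift n (j : M →ₗ[R] T) y w⁆ := by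
  obtain ⟨m, a⟩ := w
  have h : ∀ (m : M) (a : UniversalEnvelopingAlgebra R n), (m, a) = (m, 0) + (0, a) := by simp
  rw [prodRep_apply, h, h m a, map_add, map_add, lie_add, extLift_inr_ι_mul, extLift_inl,
    extLift_inl]
  simp

/-- The universal property of `M × U(n)`: it is the `g`-module freely generated over `M` by an
element on which `g` acts through `φ`. -/
theorem extLift_extAction (j : M →ₗ⁅R, g⁆ T) (y : T)
    (hy : ∀ z, ⁅z, y⁆ = extLift n (j : M →ₗ[R] T) y (φ z)) (z : g)
    (w : M × UniversalEnvelopingAlgebra R n) :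
    extLift n (j : M →ₗ[R] T) y (extAction φ z w) = ⁅z, extLift n (j : M →ₗ[R] T) y w⁆ := by
  suffices h : ∀ a z, extLift n (j : M →ₗ[R] T) y (extAction φ z (0, a)) =
      ⁅z, extLift n (j : M →ₗ[R] T) y (0, a)⁆ by
    obtain ⟨m, a⟩ := w
    rw [show ((m, a) : M × UniversalEnvelopingAlgebra R n) = (m, 0) + (0, a) by simp, map_add,
      map_add, map_add, lie_add, h, extAction_inl, extLift_inl, extLift_inl]
    simp
  clear z w
  intro a
  induction a using uea_induction with
  | one => intro z; rw [extAction_one, extLift_one, hy]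
  | add a b ha hb =>
    intro z
    rw [show ((0, a + b) : M × UniversalEnvelopingAlgebra R n) = (0, a) + (0, b) by simp]
    simp only [map_add, ha, hb, lie_add]
  | smul r a ha =>
    intro z
    rw [show ((0, r • a) : M × UniversalEnvelopingAlgebra R n) = r • (0, a) by simp]
    simp only [map_smul, ha, lie_smul]
  | mul x a ha =>
    intro z
    rw [extAction_inr_ι_mul, map_add, extLift_prodRep, ha, ha, extLift_inr_ι_mul, leibniz_lie z,
      add_comm]

end Induction

/-- The vector space `W` with the `g`-module structure given by a representation `ρ`. -/
def RepModule {R g W : Type*} [CommRing R] [LieRing g] [LieAlgebra R g] [AddCommGroup W]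
    [Module R W] (_ρ : g →ₗ⁅R⁆ Module.End R W) : Type _ := W

namespace RepModule

variable {R g W : Type*} [CommRing R] [LieRing g] [LieAlgebra R g] [AddCommGroup W]
    [Module R W] (ρ : g →ₗ⁅R⁆ Module.End R W)

instance : AddCommGroup (RepModule ρ) := inferInstanceAs (AddCommGroup W)

instance : Module R (RepModule ρ) := inferInstanceAs (Module R W)

instance : LieRingModule g (RepModule ρ) := LieRingModule.compLieHom W ρ

instance : LieModule R g (RepModule ρ) := LieModule.compLieHom W ρ

end RepModule

/-! ### The negative modes -/

/-- Induction on elements of the Virasoro algebra. -/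
theorem modes_induction {p : Virasoro → Prop} (hL : ∀ n, p (L n)) (hC : p C)
    (add : ∀ a b, p a → p b → p (a + b)) (smul : ∀ (r : ℂ) a, p a → p (r • a)) (z : Virasoro) :
    p z := by
  let P : Submodule ℂ Virasoro :=
    { carrier := {a | p a}
      add_mem' := fun ha hb => add _ _ ha hb
      zero_mem' := by simpa using smul 0 C hC
      smul_mem' := fun r a ha => smul r a ha }
  have h : P.mkQ = 0 := hom_ext
    (fun n => (Submodule.Quotient.mk_eq_zero P).2 (hL n)) ((Submodule.Quotient.mk_eq_zero P).2 hC)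
  exact (Submodule.Quotient.mk_eq_zero P).1 (LinearMap.congr_fun h z)

/-- The Lie subalgebra spanned by the modes `L k` with `k < 0`. -/
noncomputable def negModes : LieSubalgebra ℂ Virasoro :=
  { Submodule.span ℂ {z | ∃ k : ℤ, k < 0 ∧ z = L k} with
    lie_mem' := by
      intro x y hx hy
      simp only [AddSubsemigroup.mem_carrier, AddSubmonoid.mem_toSubsemigroup,
        Submodule.mem_toAddSubmonoid] at hx hy ⊢
      induction hx, hy using Submodule.span_induction₂ with
      | mem_mem x y hx hy =>
        obtain ⟨k, hk, rfl⟩ := hx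
        obtain ⟨l, hl, rfl⟩ := hy
        rw [lie_L_L, if_neg (by omega), zero_smul, add_zero]
        exact Submodule.smul_mem _ _ (Submodule.subset_span ⟨k + l, by omega, rfl⟩)
      | zero_left y hy => rw [zero_lie]; exact Submodule.zero_mem _
      | zero_right x hx => rw [lie_zero]; exact Submodule.zero_mem _
      | add_left x y z _ _ _ h h' => rw [add_lie]; exact Submodule.add_mem _ h h'
      | add_right x y z _ _ _ h h' => rw [lie_add]; exact Submodule.add_mem _ h h'
      | smul_left r x y _ _ h => rw [smul_lie]; exact Submodule.smul_mem _ r h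
      | smul_right r x y _ _ h => rw [lie_smul]; exact Submodule.smul_mem _ r h }

theorem mem_negModes {z : Virasoro} :
    z ∈ negModes ↔ z ∈ Submodule.span ℂ {z | ∃ k : ℤ, k < 0 ∧ z = L k} := Iff.rfl

theorem L_mem_negModes {k : ℤ} (hk : k < 0) : L k ∈ negModes :=
  mem_negModes.2 (Submodule.subset_span ⟨k, hk, rfl⟩)

/-- The coefficient of `C`. -/
noncomputable def central : Virasoro →ₗ[ℂ] ℂ := LinearMap.snd ℂ (ℤ →₀ ℂ) ℂ

theorem central_L (n : ℤ) : central (L n) = 0 := rfl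

theorem central_C : central C = 1 := rfl

/-- The universal enveloping algebra of the negative modes. -/
abbrev NegUEA : Type := UniversalEnvelopingAlgebra ℂ negModes

/-! ### Extensions by a logarithmic partner of a highest weight vector -/

section Ext

variable {M : Type*} [AddCommGroup M] [Module ℂ M]

/-- The values on `y = (0, 1)` of the elements of the Virasoro algebra acting on `M × U(n)`, where
`n` is the algebra of negative modes: `L 0` sends `y` to `h y + x`, `C` sends it to `c y`, the
negative modes act freely, and the positive ones annihilate `y`. -/
noncomputable def extGen (c h : ℂ) (x : M) : Virasoro →ₗ[ℂ] M × NegUEA :=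
  (Finsupp.linearCombination ℂ fun m : ℤ =>
    if hm : m < 0 then ((0, UniversalEnvelopingAlgebra.ι ℂ ⟨L m, L_mem_negModes hm⟩) : M × NegUEA)
    else if m = 0 then (x, h • 1) else 0).comp modes +
  central.smulRight (0, c • 1)

theorem extGen_L (c h : ℂ) (x : M) (m : ℤ) : extGen c h x (L m) =
    if hm : m < 0 then (0, UniversalEnvelopingAlgebra.ι ℂ ⟨L m, L_mem_negModes hm⟩)
    else if m = 0 then (x, h • 1) else 0 := by
  rw [extGen, LinearMap.add_apply, LinearMap.comp_apply, modes_L,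
    Finsupp.linearCombination_single, one_smul, LinearMap.smulRight_apply, central_L, zero_smul,
    add_zero]

theorem extGen_L_zero (c h : ℂ) (x : M) : extGen c h x (L 0) = (x, h • 1) := by
  simp [extGen_L]

theorem extGen_L_pos (c h : ℂ) (x : M) {m : ℤ} (hm : 0 < m) : extGen c h x (L m) = 0 := by
  rw [extGen_L, dif_neg (by omega), if_neg (by omega)]

theorem extGen_C (c h : ℂ) (x : M) : extGen c h x C = (0, c • 1) := by
  rw [extGen, LinearMap.add_apply, LinearMap.comp_apply, modes_C, map_zero, zero_add,
    LinearMap.smulRight_apply, central_C, one_smul]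

theorem extGen_coe (c h : ℂ) (x : M) (z : negModes) :
    extGen c h x z = (0, UniversalEnvelopingAlgebra.ι ℂ z) := by
  obtain ⟨z, hz⟩ := z
  suffices ∀ hz' : z ∈ negModes,
      extGen c h x z = (0, UniversalEnvelopingAlgebra.ι ℂ ⟨z, hz'⟩) from this hz
  induction mem_negModes.1 hz using Submodule.span_induction with
  | mem z hz'' =>
    obtain ⟨k, hk, rfl⟩ := hz''
    intro hz'
    rw [extGen_L, dif_pos hk]
  | zero =>
    intro hz'
    rw [map_zero, show (⟨0, hz'⟩ : negModes) = 0 from rfl, map_zero]; rfl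
  | add a b ha hb iha ihb =>
    intro hz'
    rw [map_add, iha ha ha, ihb hb hb, Prod.mk_add_mk, add_zero, ← map_add]
    rfl
  | smul r a ha iha =>
    intro hz'
    rw [map_smul, iha ha ha, Prod.smul_mk, smul_zero, ← map_smul]
    rfl

variable [LieRingModule Virasoro M] [LieModule ℂ Virasoro M] {c h : ℂ} {x : M}

theorem extGen_lie (hx : IsHighestWeightVector c h x) (y z : Virasoro) :
    extAction (extGen c h x) y (extGen c h x z) - extAction (extGen c h x) z (extGen c h x y) =
      extGen c h x ⁅y, z⁆ := by
  set φ := extGen c h x with hφ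
  -- The relation holds, by construction, as soon as `y` or `z` is a negative mode.
  have key : ∀ (y : negModes) (z : Virasoro),
      extAction φ y (φ z) - extAction φ z (φ y) = φ ⁅(y : Virasoro), z⁆ := by
    intro y z
    rw [extAction_coe (extGen_coe c h x), extGen_coe,
      ← mul_one (UniversalEnvelopingAlgebra.ι ℂ y), extAction_inr_ι_mul, extAction_one,
      extAction_one, ← lie_skew z, map_neg]
    abel
  have hinr : ∀ (r : ℂ) z, extAction φ z (x, r • 1) = (⁅z, x⁆, 0) + r • φ z := by
    intro r z
    rw [show ((x, r • 1) : M × NegUEA) = (x, 0) + r • (0, 1) by simp, map_add, map_smul,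
      extAction_inl, extAction_one]
  have hinr' : ∀ (r : ℂ) z, extAction φ z (0, r • 1) = r • φ z := by
    intro r z
    rw [show ((0, r • 1) : M × NegUEA) = r • (0, 1) by simp, map_smul, extAction_one]
  have hCL : ∀ n, extAction φ C (φ (L n)) - extAction φ (L n) (φ C) = φ ⁅C, L n⁆ := by
    intro n
    rw [← lie_skew, lie_C_right, neg_zero, map_zero]
    rcases lt_trichotomy n 0 with hn | rfl | hn
    · have := key ⟨L n, L_mem_negModes hn⟩ C
      rw [lie_C_right, map_zero] at this
      rw [← neg_sub, this, neg_zero]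
    · rw [extGen_L_zero, hinr, extGen_C, hinr', extGen_L_zero, hx.C_apply]
      simp [smul_smul, mul_comm]
    · rw [extGen_L_pos c h x hn, map_zero, extGen_C, hinr', extGen_L_pos c h x hn]
      simp
  let D : Virasoro →ₗ[ℂ] Virasoro →ₗ[ℂ] M × NegUEA := LinearMap.mk₂ ℂ
    (fun y z => extAction φ y (φ z) - extAction φ z (φ y) - φ ⁅y, z⁆)
    (fun _ _ _ => by simp only [map_add, LinearMap.add_apply, add_lie]; abel)
    (fun _ _ _ => by simp only [map_smul, LinearMap.smul_apply, smul_lie, smul_sub])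
    (fun _ _ _ => by simp only [map_add, LinearMap.add_apply, lie_add]; abel)
    (fun _ _ _ => by simp only [map_smul, LinearMap.smul_apply, lie_smul, smul_sub])
  suffices hD : D = 0 from sub_eq_zero.1 (LinearMap.congr_fun₂ hD y z)
  refine hom_ext (fun m => hom_ext (fun n => ?_) ?_) (hom_ext (fun n => ?_) ?_)
  · refine sub_eq_zero.2 ?_
    rcases lt_or_ge m 0 with hm | hm
    · exact key ⟨L m, L_mem_negModes hm⟩ _
    rcases lt_or_ge n 0 with hn | hn
    · have := key ⟨L n, L_mem_negModes hn⟩ (L m)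
      rw [← neg_sub, this, ← map_neg, lie_skew]
    have hpos : ∀ n : ℤ, 0 < n → extAction φ (L n) (φ (L 0)) - extAction φ (L 0) (φ (L n)) =
        φ ⁅L n, L 0⁆ := by
      intro n hn
      rw [extGen_L_zero, hinr, hx.L_pos n hn, extGen_L_pos c h x hn, lie_L_L, if_neg (by omega),
        zero_smul, add_zero, map_smul, add_zero, extGen_L_pos c h x hn]
      simp
    rcases hm.eq_or_lt with rfl | hm'
    · rcases hn.eq_or_lt with rfl | hn'
      · simp
      · rw [← neg_sub, hpos n hn', ← map_neg, lie_skew]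
    · rcases hn.eq_or_lt with rfl | hn'
      · exact hpos m hm'
      · rw [extGen_L_pos c h x hn', extGen_L_pos c h x hm', lie_L_L, if_neg (by omega),
          zero_smul, add_zero, map_smul, extGen_L_pos c h x (by omega)]
        simp
  · refine sub_eq_zero.2 ?_
    rw [← neg_sub, hCL, ← map_neg, lie_skew]
  · exact sub_eq_zero.2 (hCL n)
  · refine sub_eq_zero.2 ?_
    simp

/-- The representation of the Virasoro algebra on `M × U(n)`, an extension of a Verma module by
`M` in which the generator of the Verma module is a logarithmic partner of `x`. -/
noncomputable def extRep (hx : IsHighestWeightVector c h x) :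
    Virasoro →ₗ⁅ℂ⁆ Module.End ℂ (M × NegUEA) :=
  { extAction (extGen c h x) with
    map_lie' := fun {y z} => extAction_lie (extGen_lie hx) y z }

theorem extRep_apply (hx : IsHighestWeightVector c h x) (z : Virasoro) :
    extRep hx z = extAction (extGen c h x) z := rfl

variable {T : Type*} [AddCommGroup T] [Module ℂ T] [LieRingModule Virasoro T]
  [LieModule ℂ Virasoro T]

/-- A logarithmic partner `y` of `j x` in a module `T` extends `j` to a homomorphism from
`M × U(n)`. -/
theorem extLift_extGen (j : M →ₗ⁅ℂ, Virasoro⁆ T) {y : T}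
    (h0 : ⁅L 0, y⁆ = h • y + j x) (hC : ⁅C, y⁆ = c • y)
    (hpos : ∀ n : ℤ, 0 < n → ⁅L n, y⁆ = 0) (z : Virasoro) (w : M × NegUEA) :
    extLift negModes (j : M →ₗ[ℂ] T) y (extAction (extGen c h x) z w) =
      ⁅z, extLift negModes (j : M →ₗ[ℂ] T) y w⁆ := by
  refine extLift_extAction j y (fun z => ?_) z w
  have hr : ∀ (m : M) (r : ℂ), extLift negModes (j : M →ₗ[ℂ] T) y (m, r • 1) = j m + r • y := by
    intro m r
    rw [show ((m, r • 1) : M × NegUEA) = (m, 0) + r • (0, 1) by simp, map_add, map_smul,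
      extLift_inl, extLift_one]
    rfl
  induction z using modes_induction with
  | hL n =>
    rcases lt_trichotomy n 0 with hn | rfl | hn
    · have := extGen_coe c h x ⟨L n, L_mem_negModes hn⟩
      rw [this, ← mul_one (UniversalEnvelopingAlgebra.ι ℂ _), extLift_inr_ι_mul, extLift_one]
    · rw [extGen_L_zero, hr, h0, add_comm]
    · rw [extGen_L_pos c h x hn, map_zero, hpos n hn]
  | hC => rw [extGen_C, hr, hC]; simp
  | add a b ha hb => rw [map_add, map_add, add_lie, ha, hb]
  | smul r a ha => rw [map_smul, map_smul, smul_lie, ha]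

/-- Every vector of a module generated by a highest weight vector is obtained from it by acting
with negative modes. -/
theorem extLift_surjective {y : T} (hy : IsHighestWeightVector c h y)
    (hgen : LieSubmodule.lieSpan ℂ Virasoro {y} = ⊤) (t : T) :
    ∃ a : NegUEA, extLift negModes (0 : T →ₗ[ℂ] T) y (0, a) = t := by
  have heq := extLift_extGen (M := T) (x := 0) (0 : T →ₗ⁅ℂ, Virasoro⁆ T) (y := y)
    (by simpa using hy.L_zero) hy.C_apply hy.L_pos
  let N : LieSubmodule ℂ Virasoro T :=
    { LinearMap.range (extLift negModes (0 : T →ₗ[ℂ] T) y) with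
      lie_mem := by
        rintro z _ ⟨w, rfl⟩
        exact ⟨_, heq z w⟩ }
  have hN : N = ⊤ := by
    rw [eq_top_iff, ← hgen, LieSubmodule.lieSpan_le, Set.singleton_subset_iff]
    exact ⟨(0, 1), extLift_one _ _⟩
  obtain ⟨⟨m, a⟩, rfl⟩ : t ∈ N := hN ▸ LieSubmodule.mem_top t
  refine ⟨a, ?_⟩
  rw [show ((m, a) : T × NegUEA) = (m, 0) + (0, a) by simp, map_add, extLift_inl]
  simp

end Ext

/-! ### Verma modules -/

namespace Verma

variable (c h : ℂ)

/-- The generator of a Verma module. -/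
noncomputable def vac : Verma c h := (vermaIdeal c h).mkQ 1

variable {c h}

theorem smul_vac (a : UEA) : a • vac c h = (vermaIdeal c h).mkQ a := by
  rw [vac]
  exact (map_smul (vermaIdeal c h).mkQ a 1).symm.trans (by rw [smul_eq_mul, mul_one])

theorem smul_vac_eq_zero {a : UEA} : a • vac c h = 0 ↔ a ∈ vermaIdeal c h := by
  rw [smul_vac]
  exact Submodule.Quotient.mk_eq_zero _

theorem lie_eq_smul (z : Virasoro) (m : Verma c h) :
    ⁅z, m⁆ = UniversalEnvelopingAlgebra.ι ℂ z • m := rfl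

theorem lie_L_zero_vac : ⁅L 0, vac c h⁆ = h • vac c h := by
  rw [lie_eq_smul, ← algebraMap_smul UEA h (vac c h), ← sub_eq_zero, ← sub_smul, smul_vac_eq_zero]
  exact Submodule.subset_span (Or.inl (by simp))

theorem lie_C_vac : ⁅C, vac c h⁆ = c • vac c h := by
  rw [lie_eq_smul, ← algebraMap_smul UEA c (vac c h), ← sub_eq_zero, ← sub_smul, smul_vac_eq_zero]
  exact Submodule.subset_span (Or.inl (by simp))

theorem lie_L_pos_vac (n : ℤ) (hn : 0 < n) : ⁅L n, vac c h⁆ = 0 := by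
  rw [lie_eq_smul, smul_vac_eq_zero]
  exact Submodule.subset_span (Or.inr ⟨n, hn, rfl⟩)

theorem lieSpan_vac : LieSubmodule.lieSpan ℂ Virasoro {vac c h} = ⊤ := by
  rw [eq_top_iff]
  intro m _
  obtain ⟨a, rfl⟩ : ∃ a : UEA, a • vac c h = m := by
    obtain ⟨a, rfl⟩ := (vermaIdeal c h).mkQ_surjective m
    exact ⟨a, smul_vac a⟩
  induction a using uea_induction with
  | one => rw [one_smul]; exact LieSubmodule.subset_lieSpan rfl
  | add a b ha hb =>
    rw [add_smul]; exact add_mem (ha trivial) (hb trivial)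
  | smul r a ha =>
    rw [smul_assoc]; exact Submodule.smul_mem _ r (ha trivial)
  | mul x a ha =>
    rw [mul_smul]; exact LieSubmodule.lie_mem (x := x) _ (ha trivial)

variable {M : Type*} [AddCommGroup M] [Module ℂ M] [LieRingModule Virasoro M]
  [LieModule ℂ Virasoro M] {x : M}

/-- The action of the ideal defining the Verma module takes `(0, 1)` into `M`. -/
theorem snd_lift_extRep_eq_zero (hx : IsHighestWeightVector c h x) {a : UEA}
    (ha : a ∈ vermaIdeal c h) :
    (UniversalEnvelopingAlgebra.lift ℂ (extRep hx) a (0, 1)).2 = 0 := by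
  have hM : ∀ (b : UEA) (w : M × NegUEA), w.2 = 0 →
      (UniversalEnvelopingAlgebra.lift ℂ (extRep hx) b w).2 = 0 := by
    intro b
    induction b using uea_induction with
    | one => simp
    | add a b ha hb => intro w hw; simp [ha w hw, hb w hw]
    | smul r a ha => intro w hw; simp [ha w hw]
    | mul z a ha =>
      intro w hw
      rw [map_mul, Module.End.mul_apply, UniversalEnvelopingAlgebra.lift_ι_apply, extRep_apply]
      have := ha w hw
      generalize UniversalEnvelopingAlgebra.lift ℂ (extRep hx) a w = w' at this
      obtain ⟨m, b⟩ := w'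
      obtain rfl : b = 0 := this
      rw [extAction_inl]
  induction ha using Submodule.span_induction with
  | mem a ha =>
    rcases ha with (rfl | rfl) | ⟨n, hn, rfl⟩
    · rw [map_sub, LinearMap.sub_apply, UniversalEnvelopingAlgebra.lift_ι_apply, extRep_apply,
        extAction_one, extGen_C]
      simp
    · rw [map_sub, LinearMap.sub_apply, UniversalEnvelopingAlgebra.lift_ι_apply, extRep_apply,
        extAction_one, extGen_L_zero]
      simp
    · rw [UniversalEnvelopingAlgebra.lift_ι_apply, extRep_apply, extAction_one,
        extGen_L_pos c h x hn]
      rfl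
  | zero => simp
  | add a b _ _ ha hb => simp [ha, hb]
  | smul b a _ ha =>
    rw [smul_eq_mul, map_mul, Module.End.mul_apply]
    exact hM b _ ha

end Verma

namespace Verma

variable {c h : ℂ}
variable {M : Type*} [AddCommGroup M] [Module ℂ M] [LieRingModule Virasoro M]
  [LieModule ℂ Virasoro M] {x : M}

/-- The Verma module is free over the negative modes. -/
theorem extLift_vac_injective (hx : IsHighestWeightVector c h x) {a : NegUEA}
    (ha : extLift negModes (0 : Verma c h →ₗ[ℂ] Verma c h) (vac c h) (0, a) = 0) : a = 0 := by
  let F : NegUEA →ₐ[ℂ] UEA := UniversalEnvelopingAlgebra.lift ℂ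
    ((UniversalEnvelopingAlgebra.ι ℂ).comp negModes.incl)
  have hF : ∀ (z : negModes) a, F (UniversalEnvelopingAlgebra.ι ℂ z * a) =
      UniversalEnvelopingAlgebra.ι ℂ (z : Virasoro) * F a := by
    intro z a
    rw [map_mul, UniversalEnvelopingAlgebra.lift_ι_apply]
    rfl
  have h1 : ∀ a : NegUEA, extLift negModes (0 : Verma c h →ₗ[ℂ] Verma c h) (vac c h) (0, a) =
      F a • vac c h := by
    intro a
    induction a using uea_induction with
    | one => rw [extLift_one, map_one, one_smul]
    | add a b ha hb =>
      rw [show ((0, a + b) : Verma c h × NegUEA) = (0, a) + (0, b) by simp, map_add, ha, hb,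
        map_add, add_smul]
    | smul r a ha =>
      rw [show ((0, r • a) : Verma c h × NegUEA) = r • (0, a) by simp, map_smul, ha, map_smul,
        smul_assoc]
    | mul z a ha => rw [extLift_inr_ι_mul, ha, hF, mul_smul, lie_eq_smul]
  -- In the module `M × U(n)` the coefficient `a` can be read off from its action on `(0, 1)`.
  have h2 : ∀ a : NegUEA, UniversalEnvelopingAlgebra.lift ℂ (extRep hx) (F a) (0, 1) = (0, a) := by
    intro a
    induction a using uea_induction with
    | one => simp
    | add a b ha hb => rw [map_add, map_add, LinearMap.add_apply, ha, hb]; simp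
    | smul r a ha => rw [map_smul, map_smul, LinearMap.smul_apply, ha]; simp
    | mul z a ha =>
      rw [hF, map_mul, Module.End.mul_apply, ha, UniversalEnvelopingAlgebra.lift_ι_apply,
        extRep_apply, extAction_coe (extGen_coe c h x), prodRep_apply, lie_zero]
  rw [h1, smul_vac_eq_zero] at ha
  have := snd_lift_extRep_eq_zero hx ha
  rwa [h2] at this

/-- The vacuum does not vanish as soon as some module has a highest weight vector with the same
highest weight and central charge. -/
theorem isHighestWeightVector_vac (hx : IsHighestWeightVector c h x) :
    IsHighestWeightVector c h (vac c h) where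
  ne_zero h0 := by
    have h1 : (1 : NegUEA) = 0 := extLift_vac_injective hx (by rw [extLift_one, h0])
    have h2 := congrArg (UniversalEnvelopingAlgebra.lift ℂ (0 : negModes →ₗ⁅ℂ⁆ ℂ)) h1
    simp at h2
  L_zero := lie_L_zero_vac
  C_apply := lie_C_vac
  L_pos := lie_L_pos_vac

/-- The Verma module is isomorphic, as a vector space, to the enveloping algebra of the negative
modes. -/
noncomputable def negEquiv (hx : IsHighestWeightVector c h x) : NegUEA ≃ₗ[ℂ] Verma c h :=
  LinearEquiv.ofBijective
    ((extLift negModes (0 : Verma c h →ₗ[ℂ] Verma c h) (vac c h)) ∘ₗ LinearMap.inr ℂ _ _)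
    ⟨(injective_iff_map_eq_zero _).2 fun _ ha => extLift_vac_injective hx ha,
      fun t => extLift_surjective (isHighestWeightVector_vac hx) lieSpan_vac t⟩

theorem negEquiv_apply (hx : IsHighestWeightVector c h x) (a : NegUEA) :
    negEquiv hx a = extLift negModes (0 : Verma c h →ₗ[ℂ] Verma c h) (vac c h) (0, a) := rfl

theorem negEquiv_one (hx : IsHighestWeightVector c h x) : negEquiv hx 1 = vac c h := by
  rw [negEquiv_apply, extLift_one]

theorem negEquiv_extAction (hx : IsHighestWeightVector c h x) (z : Virasoro) (w : M × NegUEA) :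
    negEquiv hx (extAction (extGen c h x) z w).2 = ⁅z, negEquiv hx w.2⁆ := by
  have h2 : ∀ w : M × NegUEA, negEquiv hx w.2 =
      extLift negModes ((0 : M →ₗ⁅ℂ, Virasoro⁆ Verma c h) : M →ₗ[ℂ] Verma c h) (vac c h) w := by
    rintro ⟨m, a⟩
    rw [negEquiv_apply]
    simp [extLift]
  rw [h2, h2]
  exact extLift_extGen (0 : M →ₗ⁅ℂ, Virasoro⁆ Verma c h)
    (by simpa using lie_L_zero_vac) lie_C_vac lie_L_pos_vac z w

end Verma

/-! ### Weights -/

theorem mem_genEigenspace_two {M : Type*} [AddCommGroup M] [Module ℂ M]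
    {f : Module.End ℂ M} {μ : ℂ} {m : M} :
    m ∈ f.genEigenspace μ 2 ↔ f (f m - μ • m) = μ • (f m - μ • m) := by
  rw [show (2 : ℕ∞) = ((2 : ℕ) : ℕ∞) from rfl, Module.End.mem_genEigenspace_nat,
    LinearMap.mem_ker, pow_two, Module.End.mul_apply, ← sub_eq_zero (a := f _)]
  simp

/-- A diagonalisable endomorphism has no Jordan cells of rank two. -/
theorem IsDiagonalisable.genEigenspace_two_le {M : Type*} [AddCommGroup M] [Module ℂ M]
    {f : Module.End ℂ M} (hf : IsDiagonalisable f) (μ : ℂ) :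
    f.genEigenspace μ 2 ≤ f.eigenspace μ := by
  intro m hm
  have htop : m ∈ f.eigenspace μ ⊔ ⨆ ν ≠ μ, f.eigenspace ν := by
    have : (⊤ : Submodule ℂ M) ≤ f.eigenspace μ ⊔ ⨆ ν ≠ μ, f.eigenspace ν := by
      rw [← hf]
      refine iSup_le fun ν => ?_
      by_cases hν : ν = μ
      · subst hν; exact le_sup_left
      · exact le_sup_of_le_right (le_iSup₂_of_le ν hν le_rfl)
    exact this trivial
  obtain ⟨a, ha, b, hb, rfl⟩ := Submodule.mem_sup.1 htop
  have hb1 : b ∈ f.maxGenEigenspace μ := by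
    have h1 : a + b ∈ f.maxGenEigenspace μ := (f.genEigenspace μ).mono le_top hm
    have h2 : a ∈ f.maxGenEigenspace μ := (f.genEigenspace μ).mono le_top ha
    simpa using sub_mem h1 h2
  have hb2 : b ∈ ⨆ ν ≠ μ, f.maxGenEigenspace ν :=
    (iSup₂_mono fun ν _ => (f.genEigenspace ν).mono le_top) hb
  have hb0 : b = 0 :=
    (Submodule.disjoint_def.1 ((f.independent_maxGenEigenspace) μ)) b hb1 hb2
  simpa [hb0] using ha

theorem lie_C_comm {M : Type*} [AddCommGroup M] [LieRingModule Virasoro M]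
    (z : Virasoro) (m : M) : ⁅C, ⁅z, m⁆⁆ = ⁅z, ⁅C, m⁆⁆ := by
  rw [leibniz_lie, ← lie_skew, lie_C_right, neg_zero, zero_lie, zero_add]

section Weights

variable {M : Type*} [AddCommGroup M] [Module ℂ M] [LieRingModule Virasoro M]
  [LieModule ℂ Virasoro M]

/-- The mode `L 0` as an operator. -/
noncomputable abbrev L0 (M : Type*) [AddCommGroup M] [Module ℂ M] [LieRingModule Virasoro M]
    [LieModule ℂ Virasoro M] : Module.End ℂ M := LieModule.toEnd ℂ Virasoro M (L 0)

theorem lie_L_zero_L (n : ℤ) (m : M) : ⁅L 0, ⁅L n, m⁆⁆ = ⁅L n, ⁅L 0, m⁆⁆ - (n : ℂ) • ⁅L n, m⁆ := by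
  rw [leibniz_lie, lie_L_L]
  by_cases hn : n = 0
  · subst hn; simp
  · rw [if_neg (by omega)]
    simp
    abel

theorem lie_L_mem_genEigenspace (n : ℤ) {μ : ℂ} {k : ℕ} {m : M}
    (hm : m ∈ (L0 M).genEigenspace μ k) : ⁅L n, m⁆ ∈ (L0 M).genEigenspace (μ - n) k := by
  rw [Module.End.mem_genEigenspace_nat, LinearMap.mem_ker] at hm ⊢
  have h : ∀ (k : ℕ) (m : M), ((L0 M - (μ - n) • 1) ^ k) ⁅L n, m⁆ =
      ⁅L n, ((L0 M - μ • 1) ^ k) m⁆ := by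
    intro k
    induction k with
    | zero => simp
    | succ k ih =>
      intro m
      rw [pow_succ, pow_succ, Module.End.mul_apply, Module.End.mul_apply, ← ih]
      congr 1
      simp [lie_L_zero_L, sub_smul]
  rw [h, hm, lie_zero]

theorem lie_C_mem_genEigenspace {μ : ℂ} {k : ℕ} {m : M}
    (hm : m ∈ (L0 M).genEigenspace μ k) : ⁅C, m⁆ ∈ (L0 M).genEigenspace μ k := by
  refine Module.End.mapsTo_genEigenspace_of_comm
    (g := LieModule.toEnd ℂ Virasoro M C) ?_ μ k hm
  refine LinearMap.ext fun m => ?_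
  simp [lie_C_comm]

/-- The span of the generalised eigenvectors of `L 0` of rank at most `k`, as a submodule. -/
noncomputable def genWeightSubmodule (M : Type*) [AddCommGroup M] [Module ℂ M]
    [LieRingModule Virasoro M] [LieModule ℂ Virasoro M] (k : ℕ) : LieSubmodule ℂ Virasoro M :=
  { (⨆ μ : ℂ, (L0 M).genEigenspace μ k : Submodule ℂ M) with
    lie_mem := by
      intro z m hm
      simp only [AddSubsemigroup.mem_carrier, AddSubmonoid.mem_toSubsemigroup,
        Submodule.mem_toAddSubmonoid] at hm ⊢
      induction z using modes_induction with
      | hL n =>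
        induction hm using Submodule.iSup_induction' with
        | mem μ m hm =>
          exact Submodule.mem_iSup_of_mem (μ - n) (lie_L_mem_genEigenspace n hm)
        | zero => simp
        | add a b _ _ ha hb => rw [lie_add]; exact add_mem ha hb
      | hC =>
        induction hm using Submodule.iSup_induction' with
        | mem μ m hm =>
          exact Submodule.mem_iSup_of_mem μ (lie_C_mem_genEigenspace hm)
        | zero => simp
        | add a b _ _ ha hb => rw [lie_add]; exact add_mem ha hb
      | add a b ha hb => rw [add_lie]; exact add_mem ha hb
      | smul r a ha => rw [smul_lie]; exact Submodule.smul_mem _ r ha }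

theorem mem_genWeightSubmodule {k : ℕ} {m : M} :
    m ∈ genWeightSubmodule M k ↔ m ∈ ⨆ μ : ℂ, (L0 M).genEigenspace μ k := Iff.rfl

/-- The eigenspaces of `C` are submodules. -/
noncomputable def centralEigenspace (M : Type*) [AddCommGroup M] [Module ℂ M]
    [LieRingModule Virasoro M] [LieModule ℂ Virasoro M] (c : ℂ) : LieSubmodule ℂ Virasoro M :=
  { (LieModule.toEnd ℂ Virasoro M C).eigenspace c with
    lie_mem := by
      intro z m hm
      have hm' : ⁅C, m⁆ = c • m := Module.End.mem_eigenspace_iff.1 hm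
      refine Module.End.mem_eigenspace_iff.2 ?_
      rw [LieModule.toEnd_apply_apply, lie_C_comm, hm', lie_smul] }

theorem mem_centralEigenspace {c : ℂ} {m : M} : m ∈ centralEigenspace M c ↔ ⁅C, m⁆ = c • m :=
  Module.End.mem_eigenspace_iff

variable {c h : ℂ} {x : M}

/-- The weights of a highest weight module lie in `h + ℕ`, and the highest weight space is
spanned by the highest weight vector. -/
theorem IsHighestWeightVector.span_sup_eq_top (hx : IsHighestWeightVector c h x)
    (hgen : LieSubmodule.lieSpan ℂ Virasoro {x} = ⊤) :
    Submodule.span ℂ {x} ⊔ ⨆ n : ℕ, (L0 M).genEigenspace (h + (n + 1)) (1 : ℕ) = ⊤ := by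
  set P := Submodule.span ℂ {x} ⊔ ⨆ n : ℕ, (L0 M).genEigenspace (h + (n + 1)) (1 : ℕ) with hP
  have hstable : ∀ z : negModes, ∀ m ∈ P, ⁅(z : Virasoro), m⁆ ∈ P := by
    rintro ⟨z, hz⟩ m hm
    simp only
    induction mem_negModes.1 hz using Submodule.span_induction with
    | mem z hz' =>
      obtain ⟨k, hk, rfl⟩ := hz'
      obtain ⟨n, rfl⟩ : ∃ n : ℕ, k = -(n + 1 : ℤ) := ⟨(-k - 1).toNat, by omega⟩
      obtain ⟨a, ha, b, hb, rfl⟩ := Submodule.mem_sup.1 hm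
      rw [lie_add]
      refine add_mem ?_ ?_
      · obtain ⟨r, rfl⟩ := Submodule.mem_span_singleton.1 ha
        rw [lie_smul]
        refine Submodule.smul_mem _ r (Submodule.mem_sup_right (Submodule.mem_iSup_of_mem n ?_))
        have hx' : x ∈ (L0 M).genEigenspace h (1 : ℕ) :=
          Module.End.mem_eigenspace_iff.2 hx.L_zero
        convert lie_L_mem_genEigenspace (-(n + 1 : ℤ)) hx' using 3
        push_cast
        ring
      · refine Submodule.mem_sup_right ?_
        clear hm
        induction hb using Submodule.iSup_induction' with
        | mem l b hb =>
          refine Submodule.mem_iSup_of_mem (l + n + 1) ?_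
          convert lie_L_mem_genEigenspace (-(n + 1 : ℤ)) hb using 3
          push_cast
          ring
        | zero => simp
        | add a b _ _ ha hb =>
          rw [lie_add]
          exact add_mem ha hb
    | zero => simp
    | add a b ha hb iha ihb => rw [add_lie]; exact add_mem (iha ha) (ihb hb)
    | smul r a ha iha => rw [smul_lie]; exact Submodule.smul_mem _ r (iha ha)
  rw [eq_top_iff]
  intro m _
  obtain ⟨a, rfl⟩ := extLift_surjective hx hgen m
  induction a using uea_induction with
  | one => rw [extLift_one]; exact Submodule.mem_sup_left (Submodule.mem_span_singleton_self x)
  | add a b ha hb =>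
    rw [show ((0, a + b) : M × NegUEA) = (0, a) + (0, b) by simp, map_add]
    exact add_mem (ha trivial) (hb trivial)
  | smul r a ha =>
    rw [show ((0, r • a) : M × NegUEA) = r • (0, a) by simp, map_smul]
    exact Submodule.smul_mem _ r (ha trivial)
  | mul z a ha => rw [extLift_inr_ι_mul]; exact hstable z _ (ha trivial)

/-- The generalised weight space of the highest weight is spanned by the highest weight vector. -/
theorem IsHighestWeightVector.exists_eq_smul (hx : IsHighestWeightVector c h x)
    (hgen : LieSubmodule.lieSpan ℂ Virasoro {x} = ⊤) {m : M}
    (hm : m ∈ (L0 M).genEigenspace h 2) : ∃ r : ℂ, m = r • x := by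
  have htop : m ∈ Submodule.span ℂ {x} ⊔
      ⨆ n : ℕ, (L0 M).genEigenspace (h + (n + 1)) (1 : ℕ) := by
    rw [hx.span_sup_eq_top hgen]; trivial
  obtain ⟨a, ha, b, hb, rfl⟩ := Submodule.mem_sup.1 htop
  obtain ⟨r, rfl⟩ := Submodule.mem_span_singleton.1 ha
  have hx' : x ∈ (L0 M).maxGenEigenspace h :=
    ((L0 M).genEigenspace h).mono le_top (Module.End.mem_eigenspace_iff.2 hx.L_zero)
  have hb1 : b ∈ (L0 M).maxGenEigenspace h := by
    have h1 : r • x + b ∈ (L0 M).maxGenEigenspace h := ((L0 M).genEigenspace h).mono le_top hm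
    simpa using sub_mem h1 (Submodule.smul_mem _ r hx')
  have hb2 : b ∈ ⨆ ν ≠ h, (L0 M).maxGenEigenspace ν := by
    refine (iSup_le fun n => ?_ : _ ≤ (_ : Submodule ℂ M)) hb
    refine le_iSup₂_of_le (h + (n + 1)) ?_ (((L0 M).genEigenspace _).mono le_top)
    intro hn
    exact Nat.cast_add_one_ne_zero n (add_eq_left.1 hn)
  have hb0 : b = 0 :=
    (Submodule.disjoint_def.1 ((L0 M).independent_maxGenEigenspace h)) b hb1 hb2
  exact ⟨r, by rw [hb0, add_zero]⟩

/-- No weight of a highest weight module is of the form `h - n` with `n > 0`. -/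
theorem IsHighestWeightVector.eq_zero_of_mem (hx : IsHighestWeightVector c h x)
    (hgen : LieSubmodule.lieSpan ℂ Virasoro {x} = ⊤) {n : ℤ} (hn : 0 < n) {m : M}
    (hm : m ∈ (L0 M).genEigenspace (h - n) 2) : m = 0 := by
  have hm1 : m ∈ (L0 M).maxGenEigenspace (h - n) := ((L0 M).genEigenspace _).mono le_top hm
  have hn0 : (n : ℂ) ≠ 0 := by exact_mod_cast hn.ne'
  refine (Submodule.disjoint_def.1 ((L0 M).independent_maxGenEigenspace (h - n))) m hm1 ?_
  have htop : m ∈ Submodule.span ℂ {x} ⊔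
      ⨆ n : ℕ, (L0 M).genEigenspace (h + (n + 1)) (1 : ℕ) := by
    rw [hx.span_sup_eq_top hgen]; trivial
  refine (sup_le ?_ (iSup_le fun k => ?_) : _ ≤ (_ : Submodule ℂ M)) htop
  · rw [Submodule.span_singleton_le_iff_mem]
    refine Submodule.mem_iSup_of_mem h (Submodule.mem_iSup_of_mem ?_ ?_)
    · intro he
      exact hn0 (by linear_combination he)
    · exact ((L0 M).genEigenspace h).mono le_top (Module.End.mem_eigenspace_iff.2 hx.L_zero)
  · refine le_iSup₂_of_le (h + (k + 1)) ?_ (((L0 M).genEigenspace _).mono le_top)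
    intro he
    have h1 : ((k + 1 + n : ℤ) : ℂ) = 0 := by push_cast; linear_combination he
    have h2 : (k + 1 + n : ℤ) = 0 := by exact_mod_cast h1
    omega

theorem IsHighestWeightVector.lie_C (hx : IsHighestWeightVector c h x)
    (hgen : LieSubmodule.lieSpan ℂ Virasoro {x} = ⊤) (m : M) : ⁅C, m⁆ = c • m := by
  have h1 : LieSubmodule.lieSpan ℂ Virasoro {x} ≤ centralEigenspace M c := by
    rw [LieSubmodule.lieSpan_le, Set.singleton_subset_iff]
    exact mem_centralEigenspace.2 hx.C_apply
  exact mem_centralEigenspace.1 (h1 (hgen ▸ LieSubmodule.mem_top m))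

end Weights

/-! ### Staggered modules -/

section Extension

variable {c h : ℂ}
  {HL : Type*} [AddCommGroup HL] [Module ℂ HL] [LieRingModule Virasoro HL]
  {HR : Type*} [AddCommGroup HR] [Module ℂ HR] [LieRingModule Virasoro HR]
  {T : Type*} [AddCommGroup T] [Module ℂ T] [LieRingModule Virasoro T]
  {j : HL →ₗ⁅ℂ, Virasoro⁆ T} {p : T →ₗ⁅ℂ, Virasoro⁆ HR} {x : HL} {v : HR} {y : T}

/-- An extension of `HR` by `HL` is generated by generators of `HL` and lifts of generators of
`HR`. -/
theorem eq_top_of_generators (hjp : Function.Exact j p)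
    (hxgen : LieSubmodule.lieSpan ℂ Virasoro {x} = ⊤)
    (hvgen : LieSubmodule.lieSpan ℂ Virasoro {v} = ⊤) (hy : p y = v)
    {N : LieSubmodule ℂ Virasoro T} (hxN : j x ∈ N) (hyN : y ∈ N) : N = ⊤ := by
  have hj : ∀ a, j a ∈ N := by
    have : LieSubmodule.lieSpan ℂ Virasoro {x} ≤ N.comap j := by
      rw [LieSubmodule.lieSpan_le, Set.singleton_subset_iff]
      exact hxN
    intro a
    exact this (hxgen ▸ LieSubmodule.mem_top a)
  have hp : ∀ b, b ∈ N.map p := by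
    have : LieSubmodule.lieSpan ℂ Virasoro {v} ≤ N.map p := by
      rw [LieSubmodule.lieSpan_le, Set.singleton_subset_iff]
      exact (LieSubmodule.mem_map v).2 ⟨y, hyN, hy⟩
    intro b
    exact this (hvgen ▸ LieSubmodule.mem_top b)
  rw [eq_top_iff]
  intro t _
  obtain ⟨t', ht', htt⟩ := (LieSubmodule.mem_map _).1 (hp (p t))
  obtain ⟨a, ha⟩ := (hjp (t - t')).1 (by rw [map_sub, htt, sub_self])
  rw [← sub_add_cancel t t', ← ha]
  exact add_mem (hj a) ht'

variable [LieModule ℂ Virasoro HL] [LieModule ℂ Virasoro HR] [LieModule ℂ Virasoro T]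

theorem map_mem_genEigenspace {M N : Type*} [AddCommGroup M] [Module ℂ M] [LieRingModule Virasoro M]
    [LieModule ℂ Virasoro M] [AddCommGroup N] [Module ℂ N] [LieRingModule Virasoro N]
    [LieModule ℂ Virasoro N] (f : M →ₗ⁅ℂ, Virasoro⁆ N) {μ : ℂ} {m : M}
    (hm : m ∈ (L0 M).genEigenspace μ 2) : f m ∈ (L0 N).genEigenspace μ 2 := by
  rw [mem_genEigenspace_two] at hm ⊢
  simpa using congrArg f hm

theorem mem_genEigenspace_of_map {M N : Type*} [AddCommGroup M] [Module ℂ M]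
    [LieRingModule Virasoro M] [LieModule ℂ Virasoro M] [AddCommGroup N] [Module ℂ N] [LieRingModule Virasoro N]
    [LieModule ℂ Virasoro N] {f : M →ₗ⁅ℂ, Virasoro⁆ N} (hf : Function.Injective f) {μ : ℂ} {m : M}
    (hm : f m ∈ (L0 N).genEigenspace μ 2) : m ∈ (L0 M).genEigenspace μ 2 := by
  rw [mem_genEigenspace_two] at hm ⊢
  apply hf
  simpa using hm

/-- The generalised `h`-weight space of an extension is spanned by a lift of `v` and by `x`. -/
theorem exists_eq_smul_add_smul (hj : Function.Injective j) (hjp : Function.Exact j p)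
    (hx : IsHighestWeightVector c h x) (hxgen : LieSubmodule.lieSpan ℂ Virasoro {x} = ⊤)
    (hv : IsHighestWeightVector c h v) (hvgen : LieSubmodule.lieSpan ℂ Virasoro {v} = ⊤)
    (hy : p y = v) (hy2 : y ∈ (L0 T).genEigenspace h 2) {t : T}
    (ht : t ∈ (L0 T).genEigenspace h 2) : ∃ r s : ℂ, t = r • y + s • j x := by
  obtain ⟨r, hr⟩ := hv.exists_eq_smul hvgen (map_mem_genEigenspace p ht)
  obtain ⟨a, ha⟩ := (hjp (t - r • y)).1 (by rw [map_sub, map_smul, hy, hr, sub_self])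
  have ha2 : a ∈ (L0 HL).genEigenspace h 2 :=
    mem_genEigenspace_of_map hj (by rw [ha]; exact sub_mem ht (Submodule.smul_mem _ r hy2))
  obtain ⟨s, rfl⟩ := hx.exists_eq_smul hxgen ha2
  exact ⟨r, s, by rw [← map_smul, ha]; abel⟩

/-- A logarithmic partner `y` of the highest weight vector of `HL` that lifts the highest weight
vector of `HR` makes the extension indecomposable: a direct summand that contains a non-zero
multiple of `y`, up to a multiple of `x`, contains `x` and therefore everything. -/
theorem isIndecomposable_of_partner (hj : Function.Injective j) (hjp : Function.Exact j p)
    (hx : IsHighestWeightVector c h x) (hxgen : LieSubmodule.lieSpan ℂ Virasoro {x} = ⊤)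
    (hv : IsHighestWeightVector c h v) (hvgen : LieSubmodule.lieSpan ℂ Virasoro {v} = ⊤)
    (hy : p y = v) (hy0 : ⁅L 0, y⁆ = h • y + j x) : IsIndecomposable T := by
  have hjx0 : ⁅L 0, j x⁆ = h • j x := by rw [← LieModuleHom.map_lie, hx.L_zero, map_smul]
  have hy2 : y ∈ (L0 T).genEigenspace h 2 := by
    rw [mem_genEigenspace_two]
    simp [hy0, hjx0]
  refine ⟨⟨y, 0, fun h0 => hv.ne_zero (by rw [← hy, h0, map_zero])⟩, ?_⟩
  have hbig : ∀ (N : LieSubmodule ℂ Virasoro T) (r s : ℂ), r ≠ 0 → r • y + s • j x ∈ N →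
      N = ⊤ := by
    intro N r s hr hN
    have hxN : j x ∈ N := by
      have h1 : ⁅L 0, r • y + s • j x⁆ - h • (r • y + s • j x) ∈ N :=
        sub_mem (N.lie_mem hN) (N.smul_mem h hN)
      have h2 : ⁅L 0, r • y + s • j x⁆ - h • (r • y + s • j x) = r • j x := by
        rw [lie_add, lie_smul, lie_smul, hy0, hjx0]
        module
      rw [h2] at h1
      exact (Submodule.smul_mem_iff (N : Submodule ℂ T) hr).1 h1
    refine eq_top_of_generators hjp hxgen hvgen hy hxN ?_
    have h1 : r • y ∈ N := by simpa using sub_mem hN (N.smul_mem s hxN)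
    exact (Submodule.smul_mem_iff (N : Submodule ℂ T) hr).1 h1
  intro N₁ N₂ hN
  obtain ⟨y₁, hy₁, y₂, hy₂, hsum⟩ := (LieSubmodule.mem_sup _ _ y).1
    (show y ∈ N₁ ⊔ N₂ by rw [hN.sup_eq_top]; trivial)
  have hdis : ∀ a ∈ N₁, ∀ b ∈ N₂, a + b = 0 → a = 0 := by
    intro a ha b hb hab
    have : a ∈ N₁ ⊓ N₂ := ⟨ha, by rw [eq_neg_of_add_eq_zero_left hab]; exact neg_mem hb⟩
    rwa [hN.inf_eq_bot, LieSubmodule.mem_bot] at this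
  -- The components of `y` lie in its generalised weight space.
  let D : Module.End ℂ T := (L0 T - h • 1) ^ 2
  have hD : ∀ (N : LieSubmodule ℂ Virasoro T), ∀ t ∈ N, D t ∈ N := by
    intro N t ht
    have h1 : ∀ t ∈ N, (L0 T - h • 1) t ∈ N := fun t ht => by
      simpa using sub_mem (N.lie_mem ht) (N.smul_mem h ht)
    rw [show D t = (L0 T - h • 1) ((L0 T - h • 1) t) by simp only [D, pow_two]; rfl]
    exact h1 _ (h1 _ ht)
  have hDiff : ∀ t, t ∈ (L0 T).genEigenspace h 2 ↔ D t = 0 := fun t => by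
    rw [show (2 : ℕ∞) = ((2 : ℕ) : ℕ∞) from rfl, Module.End.mem_genEigenspace_nat,
      LinearMap.mem_ker]
  have hDsum : D y₁ + D y₂ = 0 := by rw [← map_add, hsum]; exact (hDiff y).1 hy2
  have hD1 : D y₁ = 0 := hdis _ (hD _ _ hy₁) _ (hD _ _ hy₂) hDsum
  have hy₁2 := (hDiff y₁).2 hD1
  obtain ⟨r, s, hrs⟩ := exists_eq_smul_add_smul hj hjp hx hxgen hv hvgen hy hy2 hy₁2
  by_cases hr : r = 0
  · have hN₂ : N₂ = ⊤ := by
      refine hbig N₂ 1 (-s) one_ne_zero ?_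
      rw [show (1 : ℂ) • y + (-s) • j x = y₂ by rw [← hsum, hrs, hr]; module]
      exact hy₂
    exact Or.inl (by rw [← hN.inf_eq_bot, hN₂, inf_top_eq])
  · have hN₁ : N₁ = ⊤ := hbig N₁ r s hr (hrs ▸ hy₁)
    exact Or.inr (by rw [← hN.inf_eq_bot, hN₁, top_inf_eq])

/-- A staggered module contains a logarithmic partner `y` of the highest weight vector `x` of its
left module: a generalised eigenvector of `L 0` that lifts the highest weight vector `v` of the
right module satisfies `(L 0 - h) y ∈ ℂ x` for weight reasons, this is not zero since `L 0` is not
diagonalisable, and the positive modes annihilate `y` since the left module has no weight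
`h - n` with `n > 0`. -/
theorem exists_partner (hj : Function.Injective j) (hjp : Function.Exact j p)
    (hp : Function.Surjective p)
    (hx : IsHighestWeightVector c h x) (hxgen : LieSubmodule.lieSpan ℂ Virasoro {x} = ⊤)
    (hv : IsHighestWeightVector c h v) (hvgen : LieSubmodule.lieSpan ℂ Virasoro {v} = ⊤)
    (hC : IsDiagonalisable (LieModule.toEnd ℂ Virasoro T C))
    (hL : ¬ IsDiagonalisable (L0 T)) (hJ : HasJordanCellsOfRankLETwo (L0 T)) :
    ∃ (y : T) (β : ℂ), β ≠ 0 ∧ p y = β • v ∧ ⁅L 0, y⁆ = h • y + j x ∧ ⁅C, y⁆ = c • y ∧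
      ∀ n : ℤ, 0 < n → ⁅L n, y⁆ = 0 := by
  obtain ⟨y, hy2, hy⟩ : ∃ y ∈ (L0 T).genEigenspace h 2, p y = v := by
    obtain ⟨y₀, hy₀⟩ := hp v
    have htop : y₀ ∈ (L0 T).genEigenspace h 2 ⊔ ⨆ ν ≠ h, (L0 T).genEigenspace ν 2 := by
      have : (⊤ : Submodule ℂ T) ≤
          (L0 T).genEigenspace h 2 ⊔ ⨆ ν ≠ h, (L0 T).genEigenspace ν 2 := by
        rw [← hJ]
        refine iSup_le fun ν => ?_
        by_cases hν : ν = h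
        · subst hν; exact le_sup_left
        · exact le_sup_of_le_right (le_iSup₂_of_le ν hν le_rfl)
      exact this trivial
    obtain ⟨y, hy, t, ht, rfl⟩ := Submodule.mem_sup.1 htop
    refine ⟨y, hy, ?_⟩
    have ht1 : p t ∈ (L0 HR).genEigenspace h 2 := by
      rw [map_add] at hy₀
      rw [eq_sub_of_add_eq' hy₀]
      refine sub_mem ?_ (map_mem_genEigenspace p hy)
      rw [mem_genEigenspace_two]
      simp [hv.L_zero]
    have ht2 : p t ∈ ⨆ ν ≠ h, (L0 HR).genEigenspace ν 2 := by
      have : ⨆ ν ≠ h, (L0 T).genEigenspace ν 2 ≤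
          (⨆ ν ≠ h, (L0 HR).genEigenspace ν 2).comap (p : T →ₗ[ℂ] HR) :=
        iSup₂_le fun ν hν t ht =>
          Submodule.mem_iSup_of_mem ν (Submodule.mem_iSup_of_mem hν (map_mem_genEigenspace p ht))
      exact this ht
    have ht0 : p t = 0 := Submodule.disjoint_def.1
      ((L0 HR).independent_genEigenspace 2 h) (p t) ht1 ht2
    rw [← hy₀, map_add, ht0, add_zero]
  obtain ⟨α, hα⟩ : ∃ α : ℂ, ⁅L 0, y⁆ = h • y + α • j x := by
    have hmem : ⁅L 0, y⁆ - h • y ∈ (L0 T).genEigenspace h 2 := by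
      refine sub_mem ?_ (Submodule.smul_mem _ h hy2)
      have := lie_L_mem_genEigenspace (k := 2) 0 hy2
      simpa using this
    obtain ⟨a, ha⟩ := (hjp (⁅L 0, y⁆ - h • y)).1 (by
      rw [map_sub, map_smul, LieModuleHom.map_lie, hy, hv.L_zero, sub_self])
    obtain ⟨α, rfl⟩ := hx.exists_eq_smul hxgen (mem_genEigenspace_of_map hj (ha ▸ hmem))
    exact ⟨α, by rw [← map_smul, ha]; abel⟩
  have hyC : ⁅C, y⁆ = c • y := by
    obtain ⟨a, ha⟩ := (hjp (⁅C, y⁆ - c • y)).1 (by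
      rw [map_sub, map_smul, LieModuleHom.map_lie, hy, hv.C_apply, sub_self])
    refine Module.End.mem_eigenspace_iff.1 (hC.genEigenspace_two_le c (?_ : y ∈ _))
    rw [mem_genEigenspace_two]
    simp only [LieModule.toEnd_apply_apply]
    rw [← ha, ← LieModuleHom.map_lie, hx.lie_C hxgen, map_smul]
  have hypos : ∀ n : ℤ, 0 < n → ⁅L n, y⁆ = 0 := by
    intro n hn
    obtain ⟨a, ha⟩ := (hjp ⁅L n, y⁆).1 (by rw [LieModuleHom.map_lie, hy, hv.L_pos n hn])
    have h1 := lie_L_mem_genEigenspace (k := 2) n hy2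
    rw [← ha] at h1 ⊢
    rw [hx.eq_zero_of_mem hxgen hn (mem_genEigenspace_of_map hj h1), map_zero]
  have hjx : ⁅L 0, j x⁆ = h • j x := by rw [← LieModuleHom.map_lie, hx.L_zero, map_smul]
  have hα0 : α ≠ 0 := by
    rintro rfl
    apply hL
    have hN : genWeightSubmodule T 1 = ⊤ := by
      refine eq_top_of_generators hjp hxgen hvgen hy
        (mem_genWeightSubmodule.2 (Submodule.mem_iSup_of_mem h ?_))
        (mem_genWeightSubmodule.2 (Submodule.mem_iSup_of_mem h ?_))
      · exact Module.End.mem_eigenspace_iff.2 hjx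
      · exact Module.End.mem_eigenspace_iff.2 (by simpa using hα)
    exact congrArg LieSubmodule.toSubmodule hN
  refine ⟨α⁻¹ • y, α⁻¹, inv_ne_zero hα0, by rw [map_smul, hy], ?_, ?_, ?_⟩
  · rw [lie_smul, hα, smul_add, smul_smul α⁻¹ α, inv_mul_cancel₀ hα0, one_smul, smul_comm]
  · rw [lie_smul, hyC, smul_comm]
  · intro n hn
    rw [lie_smul, hypos n hn, smul_zero]

end Extension

/-! ### The staggered module -/

section LogModule

variable {c h : ℂ}
  {HL : Type u} [AddCommGroup HL] [Module ℂ HL] [LieRingModule Virasoro HL] [LieModule ℂ Virasoro HL]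
  {HR : Type v} [AddCommGroup HR] [Module ℂ HR] [LieRingModule Virasoro HR]
  {x : HL}

/-- The identification of `HL × U(n)` with `HL × HR`, for a module `HR` isomorphic to the Verma
module. It places the extension in the universe `max u v`. -/
noncomputable def prodEquiv (hx : IsHighestWeightVector c h x)
    (E : HR ≃ₗ⁅ℂ, Virasoro⁆ Verma c h) : (HL × NegUEA) ≃ₗ[ℂ] HL × HR :=
  (LinearEquiv.refl ℂ HL).prodCongr ((Verma.negEquiv hx).trans E.symm.toLinearEquiv)

/-- The extension of `HR` by `HL` in which the highest weight vector of `HR` is a logarithmic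
partner of `x`. -/
abbrev LogModule (hx : IsHighestWeightVector c h x) (E : HR ≃ₗ⁅ℂ, Virasoro⁆ Verma c h) :
    Type (max u v) :=
  RepModule ((prodEquiv hx E).lieConj.toLieHom.comp (extRep hx))

namespace LogModule

variable (hx : IsHighestWeightVector c h x) (E : HR ≃ₗ⁅ℂ, Virasoro⁆ Verma c h)

/-- The linear identification of `HL × U(n)` with the extension. -/
noncomputable def equiv : (HL × NegUEA) ≃ₗ[ℂ] LogModule hx E := prodEquiv hx E

theorem lie_equiv (z : Virasoro) (w : HL × NegUEA) :
    ⁅z, equiv hx E w⁆ = equiv hx E (extAction (extGen c h x) z w) := by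
  change prodEquiv hx E (extAction (extGen c h x) z ((prodEquiv hx E).symm (prodEquiv hx E w))) = _
  rw [LinearEquiv.symm_apply_apply]
  rfl

/-- The inclusion of the left module. -/
noncomputable def inl : HL →ₗ⁅ℂ, Virasoro⁆ LogModule hx E :=
  { (equiv hx E : HL × NegUEA →ₗ[ℂ] LogModule hx E) ∘ₗ LinearMap.inl ℂ HL NegUEA with
    map_lie' := fun {z m} => by
      refine Eq.trans ?_ (lie_equiv hx E z (m, 0)).symm
      rw [extAction_inl]
      rfl }

theorem inl_apply (m : HL) : inl hx E m = equiv hx E (m, 0) := rfl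

/-- The projection onto the right module. -/
noncomputable def snd : LogModule hx E →ₗ⁅ℂ, Virasoro⁆ HR :=
  { (LinearMap.snd ℂ HL HR : HL × HR →ₗ[ℂ] HR) with
    map_lie' := fun {z m} => by
      obtain ⟨w, rfl⟩ := (equiv hx E).surjective m
      rw [lie_equiv]
      change E.symm (Verma.negEquiv hx (extAction (extGen c h x) z w).2) =
        ⁅z, E.symm (Verma.negEquiv hx w.2)⁆
      rw [Verma.negEquiv_extAction]
      exact LieModuleHom.map_lie (E.symm : Verma c h →ₗ⁅ℂ, Virasoro⁆ HR) z _ }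

theorem snd_equiv (w : HL × NegUEA) :
    snd hx E (equiv hx E w) = E.symm (Verma.negEquiv hx w.2) := rfl

/-- The logarithmic partner of the highest weight vector of the left module. -/
noncomputable def partner : LogModule hx E := equiv hx E (0, 1)

theorem lie_partner (z : Virasoro) : ⁅z, partner hx E⁆ = equiv hx E (extGen c h x z) := by
  rw [partner, lie_equiv, extAction_one]

theorem snd_partner : snd hx E (partner hx E) = E.symm (Verma.vac c h) := by
  rw [partner, snd_equiv, Verma.negEquiv_one]

theorem lie_L_zero_partner :
    ⁅L 0, partner hx E⁆ = h • partner hx E + inl hx E x := by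
  rw [lie_partner, extGen_L_zero, partner, inl_apply, ← map_smul, ← map_add]
  simp

theorem lie_C_partner : ⁅C, partner hx E⁆ = c • partner hx E := by
  rw [lie_partner, extGen_C, partner, ← map_smul]
  simp

theorem inl_injective : Function.Injective (inl hx E) := fun a b hab => by
  simpa using (equiv hx E).injective hab

theorem snd_surjective : Function.Surjective (snd hx E) := fun b => ⟨((0 : HL), b), rfl⟩

theorem exact_inl_snd : Function.Exact (inl hx E) (snd hx E) := by
  intro m
  obtain ⟨⟨a, b⟩, rfl⟩ := (equiv hx E).surjective m
  rw [snd_equiv]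
  constructor
  · intro hb
    obtain rfl : b = 0 := by
      have := (E.symm.toLinearEquiv.map_eq_zero_iff).1 hb
      simpa using this
    exact ⟨a, rfl⟩
  · rintro ⟨a', ha'⟩
    have h1 : ((a', 0) : HL × NegUEA) = (a, b) := (equiv hx E).injective ha'
    obtain rfl : 0 = b := congrArg Prod.snd h1
    rw [map_zero]
    exact map_zero (E.symm : Verma c h →ₗ⁅ℂ, Virasoro⁆ HR)

theorem isHighestWeightVector_symm_vac (hx : IsHighestWeightVector c h x)
    (E : HR ≃ₗ⁅ℂ, Virasoro⁆ Verma c h) :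
    IsHighestWeightVector c h (E.symm (Verma.vac c h)) := by
  have hvac := Verma.isHighestWeightVector_vac hx
  have hE : ∀ (z : Virasoro) m, ⁅z, E.symm m⁆ = E.symm ⁅z, m⁆ := fun z m =>
    (LieModuleHom.map_lie (E.symm : Verma c h →ₗ⁅ℂ, Virasoro⁆ HR) z m).symm
  have hEs : ∀ (r : ℂ) m, E.symm (r • m) = r • E.symm m := fun r m =>
    map_smul (E.symm : Verma c h →ₗ⁅ℂ, Virasoro⁆ HR) r m
  refine ⟨fun h0 => hvac.ne_zero ((E.symm.toLinearEquiv.map_eq_zero_iff).1 h0), ?_, ?_, ?_⟩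
  · rw [hE, hvac.L_zero, hEs]
  · rw [hE, hvac.C_apply, hEs]
  · intro n hn
    rw [hE, hvac.L_pos n hn]
    exact map_zero (E.symm : Verma c h →ₗ⁅ℂ, Virasoro⁆ HR)

theorem lieSpan_symm_vac (E : HR ≃ₗ⁅ℂ, Virasoro⁆ Verma c h) :
    LieSubmodule.lieSpan ℂ Virasoro {E.symm (Verma.vac c h)} = ⊤ := by
  rw [eq_top_iff]
  intro b _
  have h1 : LieSubmodule.lieSpan ℂ Virasoro {Verma.vac c h} ≤
      (LieSubmodule.lieSpan ℂ Virasoro {E.symm (Verma.vac c h)}).comap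
        (E.symm : Verma c h →ₗ⁅ℂ, Virasoro⁆ HR) := by
    rw [LieSubmodule.lieSpan_le, Set.singleton_subset_iff]
    exact LieSubmodule.subset_lieSpan rfl
  have h2 := h1 (show E b ∈ _ by rw [Verma.lieSpan_vac]; trivial)
  rw [LieSubmodule.mem_comap] at h2
  have h3 : E.symm (E b) = b := E.symm_apply_apply b
  exact h3 ▸ h2

variable {hx E}

theorem eq_top_of_mem (hxgen : LieSubmodule.lieSpan ℂ Virasoro {x} = ⊤)
    {N : LieSubmodule ℂ Virasoro (LogModule hx E)} (hN : partner hx E ∈ N) : N = ⊤ := by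
  refine eq_top_of_generators (exact_inl_snd hx E) hxgen (lieSpan_symm_vac E) (snd_partner hx E)
    ?_ hN
  have h1 := sub_mem (N.lie_mem (x := L 0) hN) (N.smul_mem h hN)
  rwa [lie_L_zero_partner, add_sub_cancel_left] at h1

theorem lie_L_zero_inl : ⁅L 0, inl hx E x⁆ = h • inl hx E x := by
  rw [← LieModuleHom.map_lie, hx.L_zero, map_smul]

theorem partner_mem_genEigenspace : partner hx E ∈ (L0 (LogModule hx E)).genEigenspace h 2 := by
  rw [mem_genEigenspace_two]
  simp [lie_L_zero_partner, lie_L_zero_inl]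

variable {T : Type w} [AddCommGroup T] [Module ℂ T] [LieRingModule Virasoro T]
  [LieModule ℂ Virasoro T]

/-- The homomorphism from the extension determined by a logarithmic partner `y` of `j x`. -/
noncomputable def lift (hx : IsHighestWeightVector c h x) (E : HR ≃ₗ⁅ℂ, Virasoro⁆ Verma c h)
    (j : HL →ₗ⁅ℂ, Virasoro⁆ T) {y : T} (h0 : ⁅L 0, y⁆ = h • y + j x)
    (hC : ⁅C, y⁆ = c • y) (hpos : ∀ n : ℤ, 0 < n → ⁅L n, y⁆ = 0) :
    LogModule hx E →ₗ⁅ℂ, Virasoro⁆ T :=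
  { extLift negModes (j : HL →ₗ[ℂ] T) y ∘ₗ ((equiv hx E).symm : LogModule hx E →ₗ[ℂ] _) with
    map_lie' := fun {z m} => by
      obtain ⟨w, rfl⟩ := (equiv hx E).surjective m
      rw [lie_equiv]
      simpa using extLift_extGen j h0 hC hpos z w }

variable {j : HL →ₗ⁅ℂ, Virasoro⁆ T} {y : T} (h0 : ⁅L 0, y⁆ = h • y + j x)
    (hC : ⁅C, y⁆ = c • y) (hpos : ∀ n : ℤ, 0 < n → ⁅L n, y⁆ = 0)

theorem lift_inl (m : HL) : lift hx E j h0 hC hpos (inl hx E m) = j m := by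
  change extLift negModes (j : HL →ₗ[ℂ] T) y ((equiv hx E).symm (equiv hx E (m, 0))) = _
  rw [LinearEquiv.symm_apply_apply, extLift_inl]
  rfl

theorem lift_partner : lift hx E j h0 hC hpos (partner hx E) = y := by
  change extLift negModes (j : HL →ₗ[ℂ] T) y ((equiv hx E).symm (equiv hx E (0, 1))) = _
  rw [LinearEquiv.symm_apply_apply, extLift_one]

variable [LieModule ℂ Virasoro HR]

/-- If `y` lifts a non-zero multiple of the highest weight vector of `HR` in a short exact
sequence, the homomorphism that it determines is bijective, by the five lemma. -/
theorem lift_bijective (hxgen : LieSubmodule.lieSpan ℂ Virasoro {x} = ⊤)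
    {p : T →ₗ⁅ℂ, Virasoro⁆ HR} (hj : Function.Injective j) (hjp : Function.Exact j p)
    {β : ℂ} (hβ : β ≠ 0) (hy : p y = β • E.symm (Verma.vac c h)) :
    Function.Bijective (lift hx E j h0 hC hpos) := by
  set f := lift hx E j h0 hC hpos
  have hpf : ∀ m, p (f m) = β • snd hx E m := by
    let N : LieSubmodule ℂ Virasoro (LogModule hx E) := (p.comp f - β • snd hx E).ker
    have hN : N = ⊤ := eq_top_of_mem hxgen (by
      rw [LieModuleHom.mem_ker]
      simp [f, lift_partner, hy, snd_partner])
    intro m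
    have hm : m ∈ N := hN ▸ LieSubmodule.mem_top m
    rw [LieModuleHom.mem_ker] at hm
    simpa [sub_eq_zero] using hm
  constructor
  · refine (injective_iff_map_eq_zero f).2 fun m hm => ?_
    have h1 : β • snd hx E m = 0 := by rw [← hpf, hm, map_zero]
    obtain ⟨a, rfl⟩ := (exact_inl_snd hx E m).1 ((smul_eq_zero.1 h1).resolve_left hβ)
    rw [lift_inl] at hm
    rw [hj (hm.trans (map_zero j).symm), map_zero]
  · intro t
    obtain ⟨m, hm⟩ := snd_surjective hx E (β⁻¹ • p t)
    obtain ⟨a, ha⟩ := (hjp (t - f m)).1 (by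
      rw [map_sub, hpf, hm, smul_inv_smul₀ hβ, sub_self])
    exact ⟨inl hx E a + m, by rw [map_add, lift_inl, ha, sub_add_cancel]⟩

/-- The extension is a staggered module. -/
noncomputable def staggeredModule (hx : IsHighestWeightVector c h x)
    (E : HR ≃ₗ⁅ℂ, Virasoro⁆ Verma c h)
    (hxgen : LieSubmodule.lieSpan ℂ Virasoro {x} = ⊤) : StaggeredModule.{u, v, max u v} HL HR where
  carrier := LogModule hx E
  ι := inl hx E
  π := snd hx E
  left_isHighestWeight := ⟨c, h, x, hx, hxgen⟩
  right_isHighestWeight := ⟨c, h, _, isHighestWeightVector_symm_vac hx E, lieSpan_symm_vac E⟩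
  ι_injective := inl_injective hx E
  exact := exact_inl_snd hx E
  π_surjective := snd_surjective hx E
  indecomposable := isIndecomposable_of_partner (inl_injective hx E) (exact_inl_snd hx E) hx hxgen
    (isHighestWeightVector_symm_vac hx E) (lieSpan_symm_vac E) (snd_partner hx E)
    (lie_L_zero_partner hx E)
  C_diagonalisable := by
    have hN : centralEigenspace (LogModule hx E) c = ⊤ :=
      eq_top_of_mem hxgen (mem_centralEigenspace.2 (lie_C_partner hx E))
    rw [IsDiagonalisable, eq_top_iff]
    exact le_trans (congrArg LieSubmodule.toSubmodule hN).ge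
      (le_iSup (LieModule.toEnd ℂ Virasoro (LogModule hx E) C).eigenspace c)
  L_zero_not_diagonalisable hdiag := by
    have h1 := Module.End.mem_eigenspace_iff.1
      (hdiag.genEigenspace_two_le h partner_mem_genEigenspace)
    rw [LieModule.toEnd_apply_apply, lie_L_zero_partner, add_eq_left] at h1
    exact hx.ne_zero (inl_injective hx E (h1.trans (map_zero _).symm))
  L_zero_jordan := by
    have hN : genWeightSubmodule (LogModule hx E) 2 = ⊤ := eq_top_of_mem hxgen
      (mem_genWeightSubmodule.2 (Submodule.mem_iSup_of_mem h partner_mem_genEigenspace))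
    exact congrArg LieSubmodule.toSubmodule hN

end LogModule

end LogModule

end Virasoro

theorem mainTheorem12 (c hL hR : ℝ)
    (HL : Type u) [AddCommGroup HL] [Module ℂ HL]
    [LieRingModule Virasoro HL] [LieModule ℂ Virasoro HL]
    (HR : Type v) [AddCommGroup HR] [Module ℂ HR]
    [LieRingModule Virasoro HR] [LieModule ℂ Virasoro HR]
    (hleft : Virasoro.IsHighestWeightModule (c : ℂ) (hL : ℂ) HL)
    (hright : Nonempty (HR ≃ₗ⁅ℂ, Virasoro⁆ Virasoro.Verma (c : ℂ) (hR : ℂ)))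
    (hweights : hL = hR) :
    ∃ S : Virasoro.StaggeredModule.{u, v, max u v} HL HR,
      ∀ T : Virasoro.StaggeredModule.{u, v, w} HL HR,
        ∃ e : T.carrier ≃ₗ⁅ℂ, Virasoro⁆ S.carrier, ∀ x : HL, e (T.ι x) = S.ι x := by
  subst hweights
  obtain ⟨x, hx, hxgen⟩ := hleft
  obtain ⟨E⟩ := hright
  refine ⟨Virasoro.LogModule.staggeredModule hx E hxgen, fun T => ?_⟩
  obtain ⟨y, β, hβ, hy, h0, hC, hpos⟩ := Virasoro.exists_partner T.ι_injective T.exact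
    T.π_surjective hx hxgen (Virasoro.LogModule.isHighestWeightVector_symm_vac hx E)
    (Virasoro.LogModule.lieSpan_symm_vac E) T.C_diagonalisable T.L_zero_not_diagonalisable
    T.L_zero_jordan
  have hbij := Virasoro.LogModule.lift_bijective (hx := hx) (E := E) h0 hC hpos hxgen
    T.ι_injective T.exact hβ hy
  let f := Virasoro.LogModule.lift hx E T.ι h0 hC hpos
  let e : Virasoro.LogModule hx E ≃ₗ⁅ℂ, Virasoro⁆ T.carrier :=
    { f with
      invFun := (LinearEquiv.ofBijective (f : Virasoro.LogModule hx E →ₗ[ℂ] T.carrier) hbij).symm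
      left_inv := (LinearEquiv.ofBijective
        (f : Virasoro.LogModule hx E →ₗ[ℂ] T.carrier) hbij).symm_apply_apply
      right_inv := (LinearEquiv.ofBijective
        (f : Virasoro.LogModule hx E →ₗ[ℂ] T.carrier) hbij).apply_symm_apply }
  refine ⟨e.symm, fun a => ?_⟩
  have ha : e (Virasoro.LogModule.inl hx E a) = T.ι a :=
    Virasoro.LogModule.lift_inl h0 hC hpos a
  rw [← ha]
  exact e.symm_apply_apply _
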